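/- **Setting.** Let $\Gamma_1,\dots,\Gamma_5\in\mathbb R\setminus\{0\}$ and $\Lambda\in\mathbb C$ with $|\Lambda|=1$. A *complex normalized central configuration* consists of $z_k,w_k\in\mathbb C$ $(1\le k\le5)$ and $Z_{jk},W_{jk}\in\mathbb C$ $(1\le j<k\le 5$, extended by $Z_{kj}=-Z_{jk}$, $W_{kj}=-W_{jk})$ such that $$\Lambda z_n=\sum_{j\ne n}\Gamma_jZ_{jn},\quad \overline\Lambda w_n=\sum_{j\neq n}\Gamma_jW_{jn},\quad Z_{jk}(w_k-w_j)=1,\quad W_{jk}(z_k-z_j)=1,\quad \|\mathcal Z\|=\|\mathcal W\|,$$ where $\mathcal Z=(z_k;Z_{jk})_{k;\,j<k}$, $\mathcal W=(w_k;W_{jk})_{k;\,j<k}$ and $\|\cdot\|$ is the maximum of the moduli of the components. A *singular sequence* is a sequence $(\mathcal Z^{(n)},\mathcal W^{(n)})$ of such configurations (with $\Gamma,\Lambda$ fixed) with $\|\mathcal Z^{(n)}\|=\|\mathcal W^{(n)}\|\to\infty$, for which the index of some component of maximal modulus of $\mathcal Z^{(n)}$, and likewise of $\mathcal W^{(n)}$,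 does not depend on $n$, and for which $\mathcal Z^{(n)}/\|\mathcal Z^{(n)}\|$ and $\mathcal W^{(n)}/\|\mathcal W^{(n)}\|$ converge. Its *two-colored diagram* has a $z$-circle at $k$ if $z_k\approx\|\mathcal Z\|$ and a $z$-stroke between $j\ne k$ if $Z_{jk}\approx\|\mathcal Z\|$ (where $a\approx b$ means that $a/b$ and $b/a$ are bounded for large $n$), and $w$-circles and $w$-strokes defined in the same way from $\mathcal W$. Its *$zw$-matrix* is $(A\mid B)$, with $A$ (resp. $B$) the adjacency matrix of the $z$- (resp. $w$-) strokes, circles being self-loops, i.e. diagonal entries $1$. **Rules.** For symmetric binary $N\times N$ matrices $A=(a_{ij})$, $B=(b_{ij})$ (here $N=5$), a *component* of $A$ is a maximal set $I$ of indices on which $E+A+\dots+A^{N-1}$ has only positive entries; a set is *fully stroked* (*circled*) in $A$ if $a_{ij}=1$ for all $i\neq j$ in it ($a_{ii}=1$ for all $i$ in it). The eleven matrix rules, each required for $(A,B)$ and for $(B,A)$, are: 1. (Column Sums) no column sum of $A$ is $1$, and not all column sums are $0$; 2. (Trace) $\operatorname{Tr}A\ne1$; 3. (First Triangle) $a_{ij}+a_{jk}+a_{ki}\ne2$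 for $i<j<k$; 4. (Circling) $a_{ij}(b_{ii}+b_{jj})\neq1$ for $i<j$; 5. (Trace-2 Matrices) if $\operatorname{Tr}A=2$ and $a_{ii}=a_{jj}=1$, $i\ne j$, then $a_{ij}b_{ij}=0$; 6. (Connected Components) $\sum_{i\in I}a_{ii}\ne1$ for every component $I$ of $A$; 7. (Trace-0 Principal Minors) if $a_{ii}=0$ for all $i\in I$, then $\sum_{i\in I,\,j\notin I}a_{ij}\neq1$; 8. (Fully Edged Components) if $K$ is a component of $A$ with $|K|\ge3$, fully stroked and without circles in $A$, then: (i) no component $I\supseteq K$ of $B$ has exactly $K$ as its set of $B$-circled vertices; (ii) for $x\in K$ and $K_1=K\setminus\{x\}$, no component $I\supseteq K_1$ of $B$ has exactly $K_1$ as its set of $B$-circled vertices; (iii) no component $J\supseteq K$ of $B$ with $|J|=|K|+1$ is fully stroked and without circles in $B$; (iv) no union $U\supseteq K$ of components of $B$ has exactly $K$ as its set of $B$-circled vertices; 9. (Second Triangle) if a component $K$ of $A$ has $3$ vertices and is fully stroked and circled in $A$ and in $B$, then $\operatorname{Tr}A>3$; 10. (Quadrilateral) if a component $K$ of $A$ has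 $4$ vertices, is fully stroked and circled in $A$ and fully stroked in $B$, then $\operatorname{Tr}A>4$; 11. (Dumbbells) if two distinct components of $A$ have $2$ vertices each and are fully stroked and circled in $A$ and in $B$, then $\operatorname{Tr}A+\operatorname{Tr}B>8$. **Theorem.** Let $N=5$. Up to a permutation of the vertices and an exchange of the two colors, exactly $31$ pairs $(A\mid B)$ of symmetric binary $5\times5$ matrices satisfy the eleven rules; that is, the following $31$ diagrams are pairwise inequivalent, and a pair satisfies the rules if and only if it is equivalent to one of them. Consequently, for all nonzero real $\Gamma_1,\dots,\Gamma_5$ and all $\Lambda$ with $|\Lambda|=1$, the two-colored diagram of every singular sequence of complex normalized central configurations of the five-vortex problem is equivalent to one of these $31$ diagrams. Each entry reads: $z$-circled vertices, [vertex sets inside which any two vertices are joined by a $z$-stroke] $\mid$ the same for $w$. There are no other circles or strokes. 1. $\varnothing\;[123]\;\mid\;\varnothing\;[123]$ 2. $\varnothing\;[123]\;\mid\;\varnothing\;[12345]$ 3. $\varnothing\;[123]\;\mid\;\varnothing\;[124]$ 4. $\varnothing\;[123]\;\mid\;\varnothing\;[1245]$ 5. $\varnothing\;[123]\;\mid\;\varnothing\;[145]$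 6. $\varnothing\;[1234]\;\mid\;\varnothing\;[1234]$ 7. $\varnothing\;[1234]\;\mid\;\varnothing\;[1235]$ 8. $\varnothing\;[12345]\;\mid\;\varnothing\;[12345]$ 9. $\varnothing\;[123]\;\mid\;45\;[123,45]$ 10. $\varnothing\;[123]\;\mid\;45\;[12345]$ 11. $\varnothing\;[123]\;\mid\;45\;[1245]$ 12. $\varnothing\;[123]\;\mid\;45\;[145]$ 13. $\varnothing\;[123]\;\mid\;45\;[45]$ 14. $\varnothing\;[123]\;\mid\;1234\;[1234]$ 15. $\varnothing\;[123]\;\mid\;1234\;[12345]$ 16. $\varnothing\;[123]\;\mid\;12345\;[12345]$ 17. $\varnothing\;[123]\;\mid\;12345\;[124,35]$ 18. $\varnothing\;[1234]\;\mid\;12345\;[12,345]$ 19. $\varnothing\;[1234]\;\mid\;12345\;[12345]$ 20. $45\;[145]\;\mid\;23\;[123]$ 21. $45\;[145]\;\mid\;23\;[23]$ 22. $45\;[45]\;\mid\;12\;[12]$ 23. $45\;[45]\;\mid\;123\;[123]$ 24. $345\;[12345]\;\mid\;12345\;[12,345]$ 25. $345\;[1345]\;\mid\;12345\;[12,345]$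 26. $2345\;[23,45]\;\mid\;2345\;[24,35]$ 27. $12345\;[12,345]\;\mid\;12345\;[12,345]$ 28. $12345\;[12,345]\;\mid\;12345\;[123,45]$ 29. $12345\;[12,345]\;\mid\;12345\;[12345]$ 30. $12345\;[12,345]\;\mid\;12345\;[13,245]$ 31. $12345\;[12345]\;\mid\;12345\;[12345]$ -/

import Mathlib

namespace FiveVortex

open scoped BigOperators

/-! ### The extended system, singular sequences and their two-colored diagrams -/

/-- Index set of the coordinates of `𝒵 = (z₁, …, z_N, Z₁₂, …, Z_{(N-1)N})` (and of `𝒲`): the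
vertices, and the pairs `j < k`.  The norm of `Coord N → ℂ` is the maximum of the moduli. -/
abbrev Coord (N : ℕ) : Type := Fin N ⊕ {p : Fin N × Fin N // p.1 < p.2}

/-- The vertex coordinate `z_k` of `𝒵` (or `w_k` of `𝒲`). -/
def pos {N : ℕ} (X : Coord N → ℂ) (k : Fin N) : ℂ := X (Sum.inl k)

/-- The pair coordinate `Z_{jk}` of `𝒵` (or `W_{jk}` of `𝒲`), with `Z_{jk} = -Z_{kj}` for
`k < j`.  The diagonal value is never used. -/
noncomputable def pairVar {N : ℕ} (X : Coord N → ℂ) (j k : Fin N) : ℂ :=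
  if h : j < k then X (Sum.inr ⟨(j, k), h⟩)
  else if h : k < j then -X (Sum.inr ⟨(k, j), h⟩)
  else 0

/-- `(𝒵, 𝒲)` is a complex normalized central configuration for the vorticities `Γ` and the
constant `Λ`, the rotation freedom being normalized by `‖𝒵‖ = ‖𝒲‖`. -/
structure IsNormalizedCC {N : ℕ} (Γ : Fin N → ℝ) (Λ : ℂ) (𝒵 𝒲 : Coord N → ℂ) : Prop where
  z_eq : ∀ n, Λ * pos 𝒵 n = ∑ j ∈ Finset.univ.erase n, (Γ j : ℂ) * pairVar 𝒵 j n
  w_eq : ∀ n, (starRingEnd ℂ) Λ * pos 𝒲 n =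
    ∑ j ∈ Finset.univ.erase n, (Γ j : ℂ) * pairVar 𝒲 j n
  Z_mul : ∀ j k, j < k → pairVar 𝒵 j k * (pos 𝒲 k - pos 𝒲 j) = 1
  W_mul : ∀ j k, j < k → pairVar 𝒲 j k * (pos 𝒵 k - pos 𝒵 j) = 1
  norm_eq : ‖𝒵‖ = ‖𝒲‖

/-- Singular sequences: sequences of complex normalized central configurations with
`‖𝒵⁽ⁿ⁾‖ = ‖𝒲⁽ⁿ⁾‖ → ∞`, the position of a component of maximal modulus of `𝒵⁽ⁿ⁾` and of `𝒲⁽ⁿ⁾`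
being independent of `n`, and with `𝒵⁽ⁿ⁾ / ‖𝒵⁽ⁿ⁾‖` and `𝒲⁽ⁿ⁾ / ‖𝒲⁽ⁿ⁾‖` convergent. -/
structure IsSingularSequence {N : ℕ} (Γ : Fin N → ℝ) (Λ : ℂ) (𝒵 𝒲 : ℕ → Coord N → ℂ) :
    Prop where
  isCC : ∀ n, IsNormalizedCC Γ Λ (𝒵 n) (𝒲 n)
  unbounded : Filter.Tendsto (fun n => ‖𝒵 n‖) Filter.atTop Filter.atTop
  max_z : ∃ c, ∀ n, ‖𝒵 n‖ = ‖𝒵 n c‖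
  max_w : ∃ c, ∀ n, ‖𝒲 n‖ = ‖𝒲 n c‖
  lim_z : ∃ l, Filter.Tendsto (fun n => ((‖𝒵 n‖ : ℂ)⁻¹) • 𝒵 n) Filter.atTop (nhds l)
  lim_w : ∃ l, Filter.Tendsto (fun n => ((‖𝒲 n‖ : ℂ)⁻¹) • 𝒲 n) Filter.atTop (nhds l)

/-- `a ≈ ε⁻²`, where `ε⁻² = ‖X‖` is the size of the sequence `X` of coordinate vectors. -/
def IsMaximalOrder {N : ℕ} (X : ℕ → Coord N → ℂ) (a : ℕ → ℂ) : Prop :=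
  Asymptotics.IsTheta Filter.atTop a (fun n => ‖X n‖)

open Classical in
/-- The `z`-matrix (for `X = 𝒵`) or `w`-matrix (for `X = 𝒲`) of a sequence: the adjacency matrix
of the `z`-diagram (`w`-diagram), with circles as self-loops. -/
noncomputable def colorMatrix {N : ℕ} (X : ℕ → Coord N → ℂ) : Matrix (Fin N) (Fin N) ℕ :=
  Matrix.of fun i j =>
    if i = j then (if IsMaximalOrder X (fun n => pos (X n) i) then 1 else 0)
    else (if IsMaximalOrder X (fun n => pairVar (X n) i j) then 1 else 0)

/-! ### The eleven matrix rules -/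

/-- Pairs `(A ∣ B)` of square matrices; `zw`-matrices are those with `A` and `B` symmetric and
binary. -/
abbrev ZWMatrix (N : ℕ) : Type := Matrix (Fin N) (Fin N) ℕ × Matrix (Fin N) (Fin N) ℕ

/-- `M` is symmetric with entries in `{0, 1}`. -/
def IsSymmBinary {N : ℕ} (M : Matrix (Fin N) (Fin N) ℕ) : Prop :=
  M.IsSymm ∧ ∀ i j, M i j = 0 ∨ M i j = 1

/-- Connected components of `M`: the maximal sets of indices on which
`E + M + ⋯ + M ^ (N - 1)` has only positive entries. -/
def IsConnComp {N : ℕ} (M : Matrix (Fin N) (Fin N) ℕ) (I : Finset (Fin N)) : Prop :=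
  Maximal (fun J : Finset (Fin N) =>
    ∀ i ∈ J, ∀ j ∈ J, 0 < (∑ k ∈ Finset.range N, M ^ k) i j) I

/-- Number of circles of `M` at vertices of `K`. -/
def circles {N : ℕ} (M : Matrix (Fin N) (Fin N) ℕ) (K : Finset (Fin N)) : ℕ :=
  ∑ i ∈ K, M i i

/-- Number of strokes of `M` between two distinct vertices of `K`, each counted once. -/
def strokes {N : ℕ} (M : Matrix (Fin N) (Fin N) ℕ) (K : Finset (Fin N)) : ℕ :=
  ∑ p ∈ (K ×ˢ K).filter (fun p => p.1 < p.2), M p.1 p.2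

/-- Rule of Column Sums. -/
def RuleColumnSums {N : ℕ} (M : Matrix (Fin N) (Fin N) ℕ) : Prop :=
  (∀ j, ∑ i, M i j ≠ 1) ∧ ¬ ∀ j, ∑ i, M i j = 0

/-- Rule of Trace. -/
def RuleTrace {N : ℕ} (M : Matrix (Fin N) (Fin N) ℕ) : Prop := M.trace ≠ 1

/-- First Rule of Triangle. -/
def RuleTriangle₁ {N : ℕ} (M : Matrix (Fin N) (Fin N) ℕ) : Prop :=
  ∀ i j k, i < j → j < k → M i j + M j k + M k i ≠ 2

/-- Rule of Circling (one of the two symmetric halves). -/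
def RuleCircling {N : ℕ} (A B : Matrix (Fin N) (Fin N) ℕ) : Prop :=
  ∀ i j, i < j → A i j * (B i i + B j j) ≠ 1

/-- Rule of Trace-2 Matrices. -/
def RuleTraceTwo {N : ℕ} (A B : Matrix (Fin N) (Fin N) ℕ) : Prop :=
  A.trace = 2 → ∀ i j, i ≠ j → A i i = 1 → A j j = 1 → A i j * B i j = 0

/-- Rule of Connected Components. -/
def RuleComponents {N : ℕ} (M : Matrix (Fin N) (Fin N) ℕ) : Prop :=
  ∀ I, IsConnComp M I → circles M I ≠ 1

/-- Rule of Trace-0 Principal Minors. -/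
def RuleMinors {N : ℕ} (M : Matrix (Fin N) (Fin N) ℕ) : Prop :=
  ∀ I : Finset (Fin N), (∀ i ∈ I, M i i = 0) → ∑ i ∈ I, ∑ j ∈ Iᶜ, M i j ≠ 1

/-- Rule of Fully Edged Components. -/
def RuleFullyEdged {N : ℕ} (A B : Matrix (Fin N) (Fin N) ℕ) : Prop :=
  ∀ K, IsConnComp A K → 3 ≤ K.card → (∀ i ∈ K, ∀ j ∈ K, i ≠ j → A i j = 1) →
    circles A K = 0 →
    (∀ I, IsConnComp B I → K ⊆ I →
      ¬ (circles B I = circles B K ∧ circles B K = K.card)) ∧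
    (∀ x ∈ K, ∀ I, IsConnComp B I → K.erase x ⊆ I →
      ¬ (circles B I = circles B (K.erase x) ∧
        circles B (K.erase x) = (K.erase x).card)) ∧
    (∀ J, IsConnComp B J → K ⊆ J → K.card + 1 = J.card →
      ¬ ((∀ i ∈ J, ∀ j ∈ J, i ≠ j → B i j = 1) ∧ circles B J = 0)) ∧
    (∀ F : Finset (Finset (Fin N)), (∀ I ∈ F, IsConnComp B I) → K ⊆ F.biUnion id →
      ¬ (circles B (F.biUnion id) = circles B K ∧ circles B K = K.card))

/-- Second Rule of Triangle: `9` is the product of three circles and three strokes. -/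
def RuleTriangle₂ {N : ℕ} (A B : Matrix (Fin N) (Fin N) ℕ) : Prop :=
  ∀ K, IsConnComp A K → K.card = 3 → circles A K * strokes A K = 9 →
    circles B K * strokes B K = 9 → 3 < A.trace

/-- Rule of Quadrilateral: `24` is the product of four circles and six strokes. -/
def RuleQuadrilateral {N : ℕ} (A B : Matrix (Fin N) (Fin N) ℕ) : Prop :=
  ∀ K, IsConnComp A K → K.card = 4 → circles A K * strokes A K = 24 →
    strokes B K = 6 → 4 < A.trace

/-- Rule of Dumbbells: two circles joined by one stroke in both colors, at each of two components.
(Counting every stroke once, the product of circles and strokes is `2`.) -/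
def RuleDumbbells {N : ℕ} (A B : Matrix (Fin N) (Fin N) ℕ) : Prop :=
  ∀ K₁ K₂, IsConnComp A K₁ → IsConnComp A K₂ → K₁ ≠ K₂ →
    (∀ K, K = K₁ ∨ K = K₂ →
      K.card = 2 ∧ circles A K * strokes A K = 2 ∧ circles B K * strokes B K = 2) →
    8 < A.trace + B.trace

/-- All rules on a single matrix. -/
def SingleRules {N : ℕ} (M : Matrix (Fin N) (Fin N) ℕ) : Prop :=
  RuleColumnSums M ∧ RuleTrace M ∧ RuleTriangle₁ M ∧ RuleComponents M ∧ RuleMinors M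

/-- All rules coupling a matrix with the matrix of the other color. -/
def MixedRules {N : ℕ} (A B : Matrix (Fin N) (Fin N) ℕ) : Prop :=
  RuleCircling A B ∧ RuleTraceTwo A B ∧ RuleFullyEdged A B ∧ RuleTriangle₂ A B ∧
    RuleQuadrilateral A B ∧ RuleDumbbells A B

/-- `(A ∣ B)` satisfies the eleven matrix rules, each of them also with the colors switched. -/
def SatisfiesRules {N : ℕ} (P : ZWMatrix N) : Prop :=
  SingleRules P.1 ∧ SingleRules P.2 ∧ MixedRules P.1 P.2 ∧ MixedRules P.2 P.1

/-- Two `zw`-matrices describe the same diagram, up to a permutation of the vertices and possibly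
an exchange of the two colors. -/
def SameDiagram {N : ℕ} (P Q : ZWMatrix N) : Prop :=
  ∃ σ : Equiv.Perm (Fin N),
    (Q.1 = P.1.submatrix σ σ ∧ Q.2 = P.2.submatrix σ σ) ∨
    (Q.1 = P.2.submatrix σ σ ∧ Q.2 = P.1.submatrix σ σ)

/-! ### The list of the 31 diagrams -/

/-- The one-color matrix with circles at the vertices of `C`, and with a stroke between two
distinct vertices when some member of `S` contains both. -/
def oneColor (C : Finset (Fin 5)) (S : List (Finset (Fin 5))) : Matrix (Fin 5) (Fin 5) ℕ :=
  Matrix.of fun i j =>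
    if i = j then (if i ∈ C then 1 else 0)
    else (if ∃ K ∈ S, i ∈ K ∧ j ∈ K then 1 else 0)

/-- The two-colored diagram with `z`-circles `C`, `z`-strokes inside the members of `S`,
`w`-circles `C'` and `w`-strokes inside the members of `S'`. -/
def mk5 (C : Finset (Fin 5)) (S : List (Finset (Fin 5)))
    (C' : Finset (Fin 5)) (S' : List (Finset (Fin 5))) : ZWMatrix 5 :=
  (oneColor C S, oneColor C' S')

/-- The 31 diagrams of the five-vortex problem, with vertices `0, 1, 2, 3, 4`. -/
def diagrams : List (ZWMatrix 5) :=
  [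
    mk5 ∅ [{0, 1, 2}] ∅ [{0, 1, 2}],
    mk5 ∅ [{0, 1, 2}] ∅ [{0, 1, 2, 3, 4}],
    mk5 ∅ [{0, 1, 2}] ∅ [{0, 1, 3}],
    mk5 ∅ [{0, 1, 2}] ∅ [{0, 1, 3, 4}],
    mk5 ∅ [{0, 1, 2}] ∅ [{0, 3, 4}],
    mk5 ∅ [{0, 1, 2, 3}] ∅ [{0, 1, 2, 3}],
    mk5 ∅ [{0, 1, 2, 3}] ∅ [{0, 1, 2, 4}],
    mk5 ∅ [{0, 1, 2, 3, 4}] ∅ [{0, 1, 2, 3, 4}],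
    mk5 ∅ [{0, 1, 2}] {3, 4} [{0, 1, 2}, {3, 4}],
    mk5 ∅ [{0, 1, 2}] {3, 4} [{0, 1, 2, 3, 4}],
    mk5 ∅ [{0, 1, 2}] {3, 4} [{0, 1, 3, 4}],
    mk5 ∅ [{0, 1, 2}] {3, 4} [{0, 3, 4}],
    mk5 ∅ [{0, 1, 2}] {3, 4} [{3, 4}],
    mk5 ∅ [{0, 1, 2}] {0, 1, 2, 3} [{0, 1, 2, 3}],
    mk5 ∅ [{0, 1, 2}] {0, 1, 2, 3} [{0, 1, 2, 3, 4}],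
    mk5 ∅ [{0, 1, 2}] {0, 1, 2, 3, 4} [{0, 1, 2, 3, 4}],
    mk5 ∅ [{0, 1, 2}] {0, 1, 2, 3, 4} [{0, 1, 3}, {2, 4}],
    mk5 ∅ [{0, 1, 2, 3}] {0, 1, 2, 3, 4} [{0, 1}, {2, 3, 4}],
    mk5 ∅ [{0, 1, 2, 3}] {0, 1, 2, 3, 4} [{0, 1, 2, 3, 4}],
    mk5 {3, 4} [{0, 3, 4}] {1, 2} [{0, 1, 2}],
    mk5 {3, 4} [{0, 3, 4}] {1, 2} [{1, 2}],
    mk5 {3, 4} [{3, 4}] {0, 1} [{0, 1}],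
    mk5 {3, 4} [{3, 4}] {0, 1, 2} [{0, 1, 2}],
    mk5 {2, 3, 4} [{0, 1, 2, 3, 4}] {0, 1, 2, 3, 4} [{0, 1}, {2, 3, 4}],
    mk5 {2, 3, 4} [{0, 2, 3, 4}] {0, 1, 2, 3, 4} [{0, 1}, {2, 3, 4}],
    mk5 {1, 2, 3, 4} [{1, 2}, {3, 4}] {1, 2, 3, 4} [{1, 3}, {2, 4}],
    mk5 {0, 1, 2, 3, 4} [{0, 1}, {2, 3, 4}] {0, 1, 2, 3, 4} [{0, 1}, {2, 3, 4}],
    mk5 {0, 1, 2, 3, 4} [{0, 1}, {2, 3, 4}] {0, 1, 2, 3, 4} [{0, 1, 2}, {3, 4}],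
    mk5 {0, 1, 2, 3, 4} [{0, 1}, {2, 3, 4}] {0, 1, 2, 3, 4} [{0, 1, 2, 3, 4}],
    mk5 {0, 1, 2, 3, 4} [{0, 1}, {2, 3, 4}] {0, 1, 2, 3, 4} [{0, 2}, {1, 3, 4}],
    mk5 {0, 1, 2, 3, 4} [{0, 1, 2, 3, 4}] {0, 1, 2, 3, 4} [{0, 1, 2, 3, 4}]]

end FiveVortex

namespace FiveVortex

/-! ### Boolean colors and their enumeration -/

/-! The proof has a combinatorial half and an analytic half that meet in the eleven rules.

Combinatorics. For a symmetric binary matrix the first triangle rule says that being equal or joined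
by a stroke is an equivalence relation. A color is then a partition of the five vertices together
with a set of circles, and the connected components are the blocks of the partition. The rules
become Boolean checks, invariant under relabelling (`satisfiesRules_iff`, `singleB_perm`,
`mixedB_perm`). The kernel runs through all such colors: each one that passes the single-color
checks is a relabelling of one of seventeen representatives, and each representative that is
compatible with it yields a listed pair (`enumeration_eq`). A second computation checks the listed
diagrams themselves, and a pair of numerical invariants separates them.

Analysis. Divide a singular sequence by its norm $R$ and pass to the limit. Circles and strokes are
exactly the nonzero limits (`isMaximalOrder_iff`). Three facts carry the rules. Rescaling
$Z_{jk}(w_k-w_j)=1$ shows that a $z$-stroke identifies the $w$-limits of its ends and that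
$R(w_k-w_j)$ converges to the inverse of the limit of $Z_{jk}/R$ (`wt_eq_of_stroke`,
`tendsto_of_stroke`). Antisymmetry makes $\sum\Gamma_k z_k$ vanish in the limit over any set without
outgoing strokes (`sum_zt_eq_zero`). On a fully stroked component $K$ with common $z$-limit $c$, the
rescaled $w$-moment $S$ satisfies $2\Lambda cS=(\sum_K\Gamma_k)^2-\sum_K\Gamma_k^2$
(`exists_moment_limit`).

When all circled vertices of a color form one cluster, their total vorticity is zero and their
moment in the other color is $o(1/R)$ (`tendsto_of_cluster`). Together with the moment identity this
would force $\sum\Gamma_k^2=0$, impossible for nonzero real vorticities. The rules of triangle and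
quadrilateral, and one case of dumbbells, come from this conflict. The trace-2 rule and the other
case of dumbbells come from the vanishing moment of a pair with opposite vorticities. The fully
edged rule comes from $c=0$. -/

/-- A one-color diagram on five vertices, circles being the diagonal entries. -/
abbrev Color : Type := Fin 5 → Fin 5 → Bool

/-- Conjunction, in a form that the kernel evaluates quickly. -/
def conj (p q : Bool) : Bool := Bool.rec false q p

/-- Disjunction. -/
def disj (p q : Bool) : Bool := Bool.rec q true p

/-- Negation. -/
def neg (p : Bool) : Bool := Bool.rec true false p

/-- The truth value as a number. -/
def num (p : Bool) : ℕ := Bool.rec 0 1 p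

local infixr:35 "∧ᵇ" => conj
local infixr:30 "∨ᵇ" => disj
local notation:max "¬ᵇ" b:40 => neg b

/-- Conjunction over the five vertices. -/
def all5 (f : Fin 5 → Bool) : Bool :=
  f ⟨0, by decide⟩ ∧ᵇ (f ⟨1, by decide⟩ ∧ᵇ (f ⟨2, by decide⟩ ∧ᵇ (f ⟨3, by decide⟩ ∧ᵇ
    f ⟨4, by decide⟩)))

/-- Disjunction over the five vertices. -/
def any5 (f : Fin 5 → Bool) : Bool :=
  f ⟨0, by decide⟩ ∨ᵇ (f ⟨1, by decide⟩ ∨ᵇ (f ⟨2, by decide⟩ ∨ᵇ (f ⟨3, by decide⟩ ∨ᵇ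
    f ⟨4, by decide⟩)))

/-- Number of vertices at which `f` holds. -/
def count5 (f : Fin 5 → Bool) : ℕ :=
  num (f ⟨0, by decide⟩) + num (f ⟨1, by decide⟩) + num (f ⟨2, by decide⟩) +
    num (f ⟨3, by decide⟩) + num (f ⟨4, by decide⟩)

/-- Equality of truth values. -/
def same (p q : Bool) : Bool := Bool.rec (¬ᵇq) q p

/-- Equality of vertices. -/
def eq5 (i j : Fin 5) : Bool := Nat.beq i.val j.val

/-- Boolean implication. -/
def imp (p q : Bool) : Bool := Bool.rec true q p

theorem conj_iff {p q : Bool} : (p ∧ᵇ q) = true ↔ p = true ∧ q = true := by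
  cases p <;> simp [conj]

theorem disj_iff {p q : Bool} : (p ∨ᵇ q) = true ↔ p = true ∨ q = true := by
  cases p <;> simp [disj]

theorem neg_iff {p : Bool} : (¬ᵇp) = true ↔ ¬ p = true := by
  cases p <;> simp [neg]

theorem imp_iff {p q : Bool} : imp p q = true ↔ (p = true → q = true) := by
  cases p <;> simp [imp]

theorem same_iff {p q : Bool} : same p q = true ↔ p = q := by
  cases p <;> cases q <;> simp [same, neg]

theorem num_eq (p : Bool) : num p = if p = true then 1 else 0 := by
  cases p <;> simp [num]

theorem all5_iff {f : Fin 5 → Bool} : all5 f = true ↔ ∀ i, f i = true := by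
  simp [all5, conj_iff, Fin.forall_fin_succ]

theorem any5_iff {f : Fin 5 → Bool} : any5 f = true ↔ ∃ i, f i = true := by
  simp [any5, disj_iff, Fin.exists_fin_succ]

theorem count5_eq (f : Fin 5 → Bool) : count5 f = ∑ i, num (f i) := by
  rw [Fin.sum_univ_five]; rfl

theorem eq5_iff {i j : Fin 5} : eq5 i j = true ↔ i = j := by
  simp [eq5, Fin.ext_iff]

/-- Equality or adjacency. -/
def rel (a : Color) (i j : Fin 5) : Bool := eq5 i j ∨ᵇ a i j

/-- The strokes are transitive. -/
def transB (a : Color) : Bool :=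
  all5 fun i => all5 fun j => all5 fun k => imp (a i j ∧ᵇ a j k) (rel a i k)

/-- The single-matrix rules, for transitive strokes. -/
def singleB (a : Color) : Bool :=
  (¬ᵇNat.beq (count5 fun i => a i i) 1 ∧ᵇ
    (all5 (fun i => ¬ᵇNat.beq (count5 (a i)) 1) ∧ᵇ
    (all5 (fun i => ¬ᵇNat.beq (count5 fun j => rel a i j ∧ᵇ a j j) 1) ∧ᵇ
    any5 (fun i => any5 fun j => a i j))))

/-- Rule of Circling. -/
def circlingB (a b : Color) : Bool :=
  all5 fun i => all5 fun j => imp (a i j) (same (b i i) (b j j))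

/-- Rule of Trace-2 Matrices. -/
def traceTwoB (a b : Color) : Bool :=
  imp (Nat.beq (count5 fun i => a i i) 2)
    (all5 fun i => all5 fun j => eq5 i j ∨ᵇ ¬ᵇ(a i i ∧ᵇ a j j ∧ᵇ a i j ∧ᵇ b i j))

/-- Rule of Fully Edged Components for the component `K`. -/
def fullyEdgedAtB (b : Color) (K : Fin 5 → Bool) : Bool :=
  all5 (fun y =>
    all5 (fun x => imp (K x ∧ᵇ all5 fun z => imp (K z ∧ᵇ ¬ᵇeq5 z x) (rel b y z))
      (¬ᵇall5 fun z => same (rel b y z ∧ᵇ b z z) (K z ∧ᵇ ¬ᵇeq5 z x))) ∧ᵇ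
    ¬ᵇ(all5 (fun z => imp (K z) (rel b y z)) ∧ᵇ (Nat.beq (count5 K + 1) (count5 (rel b y)) ∧ᵇ
      all5 fun z => imp (rel b y z) (¬ᵇb z z)))) ∧ᵇ
  ¬ᵇall5 fun z => same ((any5 fun x => K x ∧ᵇ rel b x z) ∧ᵇ b z z) (K z)

/-- Rule of Fully Edged Components. -/
def fullyEdgedB (a b : Color) : Bool :=
  all5 fun i => imp (Nat.ble 3 (count5 (rel a i)) ∧ᵇ all5 fun z => imp (rel a i z) (¬ᵇa z z))
    (fullyEdgedAtB b (rel a i))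

/-- Two vertices of `K` are always joined in `b`. -/
def fullB (b : Color) (K : Fin 5 → Bool) : Bool :=
  all5 fun x => all5 fun y => imp (K x ∧ᵇ K y) (rel b x y)

/-- All vertices of `K` are circled in `b`. -/
def circledB (b : Color) (K : Fin 5 → Bool) : Bool :=
  all5 fun x => imp (K x) (b x x)

/-- Second Rule of Triangle and Rule of Quadrilateral. -/
def polygonB (a b : Color) : Bool :=
  all5 fun i => imp (circledB a (rel a i))
    (imp (Nat.beq (count5 (rel a i)) 3 ∧ᵇ (circledB b (rel a i) ∧ᵇ fullB b (rel a i)))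
      (Nat.ble 4 (count5 fun i => a i i)) ∧ᵇ
    imp (Nat.beq (count5 (rel a i)) 4 ∧ᵇ fullB b (rel a i))
      (Nat.ble 5 (count5 fun i => a i i)))

/-- A dumbbell component at `i`. -/
def dumbbellAtB (a b : Color) (i : Fin 5) : Bool :=
  Nat.beq (count5 (rel a i)) 2 ∧ᵇ (circledB a (rel a i) ∧ᵇ (circledB b (rel a i) ∧ᵇ
    fullB b (rel a i)))

/-- Rule of Dumbbells. -/
def dumbbellB (a b : Color) : Bool :=
  all5 fun i => imp (dumbbellAtB a b i) (all5 fun j =>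
    imp (¬ᵇrel a i j ∧ᵇ dumbbellAtB a b j)
      (Nat.ble 9 ((count5 fun i => a i i) + count5 fun i => b i i)))

/-- The mixed rules. -/
def mixedB (a b : Color) : Bool :=
  circlingB a b ∧ᵇ (traceTwoB a b ∧ᵇ (polygonB a b ∧ᵇ (dumbbellB a b ∧ᵇ fullyEdgedB a b)))

/-! ### Isomorphism search -/

/-- `s : Fin 5 → Fin 5` given by its five values. -/
def pick {α : Type} (x₀ x₁ x₂ x₃ x₄ : α) (i : Fin 5) : α :=
  Nat.rec x₀ (fun i _ => Nat.rec x₁ (fun i _ => Nat.rec x₂ (fun i _ =>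
    Nat.rec x₃ (fun _ _ => x₄) i) i) i) i.val

/-- Compatibility of sending `i` to `x` and `j` to `y`. -/
def compat (a b a' b' : Color) (i j x y : Fin 5) : Bool :=
  ¬ᵇeq5 x y ∧ᵇ (same (a x y) (a' i j) ∧ᵇ same (b x y) (b' i j))

/-- Compatibility of sending `i` to `x`. -/
def compat₁ (a b a' b' : Color) (i x : Fin 5) : Bool :=
  same (a x x) (a' i i) ∧ᵇ same (b x x) (b' i i)

/-- Backtracking search for a relabelling of `(a, b)` into `(a', b')`. -/
def isoB (a b a' b' : Color) : Bool :=
  let C := compat a b a' b'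
  let C₁ := compat₁ a b a' b'
  any5 fun s₀ => C₁ ⟨0, by decide⟩ s₀ ∧ᵇ
  any5 fun s₁ => C₁ ⟨1, by decide⟩ s₁ ∧ᵇ C ⟨0, by decide⟩ ⟨1, by decide⟩ s₀ s₁ ∧ᵇ
  any5 fun s₂ => C₁ ⟨2, by decide⟩ s₂ ∧ᵇ C ⟨0, by decide⟩ ⟨2, by decide⟩ s₀ s₂ ∧ᵇ
    C ⟨1, by decide⟩ ⟨2, by decide⟩ s₁ s₂ ∧ᵇ
  any5 fun s₃ => C₁ ⟨3, by decide⟩ s₃ ∧ᵇ C ⟨0, by decide⟩ ⟨3, by decide⟩ s₀ s₃ ∧ᵇ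
    C ⟨1, by decide⟩ ⟨3, by decide⟩ s₁ s₃ ∧ᵇ C ⟨2, by decide⟩ ⟨3, by decide⟩ s₂ s₃ ∧ᵇ
  any5 fun s₄ => C₁ ⟨4, by decide⟩ s₄ ∧ᵇ C ⟨0, by decide⟩ ⟨4, by decide⟩ s₀ s₄ ∧ᵇ
    C ⟨1, by decide⟩ ⟨4, by decide⟩ s₁ s₄ ∧ᵇ C ⟨2, by decide⟩ ⟨4, by decide⟩ s₂ s₄ ∧ᵇ
    C ⟨3, by decide⟩ ⟨4, by decide⟩ s₃ s₄

/-! ### Evaluated tables, one-color representatives and the exhaustive enumeration -/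

/-- Evaluate `b` before applying `f`. -/
def force {β : Type} (b : Bool) (f : Bool → β) : β :=
  match b with
  | true => f true
  | false => f false

theorem force_eq {β : Type} (b : Bool) (f : Bool → β) : force b f = f b := by cases b <;> rfl

/-- The color with given circles and strokes. -/
def mkColor (c₀ c₁ c₂ c₃ c₄ e₀₁ e₀₂ e₁₂ e₀₃ e₁₃ e₂₃ e₀₄ e₁₄ e₂₄ e₃₄ : Bool) : Color :=
  fun i => pick (pick c₀ e₀₁ e₀₂ e₀₃ e₀₄) (pick e₀₁ c₁ e₁₂ e₁₃ e₁₄) (pick e₀₂ e₁₂ c₂ e₂₃ e₂₄)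
    (pick e₀₃ e₁₃ e₂₃ c₃ e₃₄) (pick e₀₄ e₁₄ e₂₄ e₃₄ c₄) i

/-- Evaluate all entries of a symmetric color before applying `f`. -/
def freeze {β : Type} (a : Color) (f : Color → β) : β :=
  force (a 0 0) fun c₀ => force (a 1 1) fun c₁ => force (a 2 2) fun c₂ =>
  force (a 3 3) fun c₃ => force (a 4 4) fun c₄ => force (a 0 1) fun e₀₁ =>
  force (a 0 2) fun e₀₂ => force (a 1 2) fun e₁₂ => force (a 0 3) fun e₀₃ =>
  force (a 1 3) fun e₁₃ => force (a 2 3) fun e₂₃ => force (a 0 4) fun e₀₄ =>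
  force (a 1 4) fun e₁₄ => force (a 2 4) fun e₂₄ => force (a 3 4) fun e₃₄ =>
  f (mkColor c₀ c₁ c₂ c₃ c₄ e₀₁ e₀₂ e₁₂ e₀₃ e₁₃ e₂₃ e₀₄ e₁₄ e₂₄ e₃₄)

theorem mkColor_self {a : Color} (h : ∀ i j, a i j = a j i) :
    mkColor (a 0 0) (a 1 1) (a 2 2) (a 3 3) (a 4 4) (a 0 1) (a 0 2) (a 1 2) (a 0 3) (a 1 3)
      (a 2 3) (a 0 4) (a 1 4) (a 2 4) (a 3 4) = a := by
  funext i j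
  fin_cases i <;> fin_cases j <;> first | rfl | exact h _ _

/-- Freezing replaces every entry by a literal, so that the kernel does not recompute it at each
use. Only entries on and above the diagonal are stored, hence the symmetry hypothesis. -/
theorem freeze_eq {β : Type} {a : Color} (h : ∀ i j, a i j = a j i) (f : Color → β) :
    freeze a f = f a := by
  simp only [freeze, force_eq, mkColor_self h]

/-- Evaluate a list of pairs of colors before applying `f`. -/
def freezeList {β : Type} : List (Color × Color) → (List (Color × Color) → β) → β
  | [], f => f []
  | p :: l, f => freeze p.1 fun a => freeze p.2 fun b => freezeList l fun l' => f ((a, b) :: l')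

theorem freezeList_eq {β : Type} {l : List (Color × Color)}
    (h : ∀ p ∈ l, (∀ i j, p.1 i j = p.1 j i) ∧ ∀ i j, p.2 i j = p.2 j i)
    (f : List (Color × Color) → β) : freezeList l f = f l := by
  induction l generalizing f with
  | nil => rfl
  | cons p l ih =>
    have hp := h p (by simp)
    simp only [freezeList, freeze_eq hp.1, freeze_eq hp.2]
    exact ih (fun q hq => h q (by simp [hq])) _

/-- Conjunction over both truth values. -/
def allB (f : Bool → Bool) : Bool := f true ∧ᵇ f false

theorem allB_iff {f : Bool → Bool} : allB f = true ↔ ∀ b, f b = true := by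
  simp [allB, conj_iff, Bool.forall_bool, and_comm]

/-- All symmetric colors with transitive strokes satisfy `p`. -/
def allColors (p : Color → Bool) : Bool :=
  allB fun e₀₁ => allB fun e₀₂ => allB fun e₁₂ => allB fun e₀₃ => allB fun e₁₃ =>
  allB fun e₂₃ => allB fun e₀₄ => allB fun e₁₄ => allB fun e₂₄ => allB fun e₃₄ =>
  imp (transB (mkColor false false false false false e₀₁ e₀₂ e₁₂ e₀₃ e₁₃ e₂₃ e₀₄ e₁₄ e₂₄ e₃₄))
    (allB fun c₀ => allB fun c₁ => allB fun c₂ => allB fun c₃ => allB fun c₄ =>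
      p (mkColor c₀ c₁ c₂ c₃ c₄ e₀₁ e₀₂ e₁₂ e₀₃ e₁₃ e₂₃ e₀₄ e₁₄ e₂₄ e₃₄))

/-- The color of a binary matrix. -/
def toColor (M : Matrix (Fin 5) (Fin 5) ℕ) : Color := fun i j => Nat.beq (M i j) 1

/-- Representatives of the one-color diagrams. -/
def reps : List Color :=
  [(true, true, true, true, true), (false, true, true, true, true),
    (false, false, true, true, true), (false, false, false, true, true),
    (false, false, false, false, false)].map
      (fun c => mkColor c.1 c.2.1 c.2.2.1 c.2.2.2.1 c.2.2.2.2
        true true true true true true true true true true) ++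
  [(true, true, true, true), (false, true, true, true),
    (false, false, true, true), (false, false, false, false)].map
      (fun c => mkColor false c.1 c.2.1 c.2.2.1 c.2.2.2
        false false true false true true false true true true) ++
  [(true, true, true), (false, true, true), (false, false, false)].map
      (fun c => mkColor true true c.1 c.2.1 c.2.2
        true false false false false true false false true true) ++
  [(true, true, true), (false, true, true), (false, false, false)].map
      (fun c => mkColor false false c.1 c.2.1 c.2.2
        false false false false false true false false true true) ++
  [mkColor false true true true true false false true false false false false false false true,
    mkColor false false false true true false false false false false false false false false true]

/-- The pair `(a, b)` is one of the pairs of `l`, up to relabelling and exchange of colors. -/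
def listedB (l : List (Color × Color)) (a b : Color) : Bool :=
  l.any fun d => isoB d.1 d.2 a b ∨ᵇ isoB d.2 d.1 a b

/-- The result of the enumeration. -/
def enumeration : Bool :=
  freezeList (diagrams.map fun d => (toColor d.1, toColor d.2)) fun l =>
  allColors fun b => imp (singleB b) ((reps.any fun r => isoB b b r r) ∧ᵇ
    reps.all fun a => imp (mixedB a b) (imp (mixedB b a) (listedB l a b)))

set_option maxRecDepth 100000 in
-- The transitivity guard reduces the 1024 stroke patterns to the 52 partitions of five points, each
-- with 32 choices of circles. One loop serves two purposes: it brings any admissible color to a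
-- representative, and it pairs any admissible color with every representative.
theorem enumeration_eq : enumeration = true := by decide +kernel

/-! ### Consequences of the enumeration -/

theorem transB_iff {a : Color} :
    transB a = true ↔ ∀ i j k, a i j = true → a j k = true → i = k ∨ a i k = true := by
  simp only [transB, all5_iff, imp_iff, conj_iff, rel, disj_iff, eq5_iff, and_imp]

theorem allColors_apply {p : Color → Bool} (hp : allColors p = true) {a : Color}
    (ha : ∀ i j, a i j = a j i) (ht : transB a = true) : p a = true := by
  have h := hp
  simp only [allColors, allB_iff, imp_iff] at h
  have := h (a 0 1) (a 0 2) (a 1 2) (a 0 3) (a 1 3) (a 2 3) (a 0 4) (a 1 4) (a 2 4) (a 3 4) ?_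
    (a 0 0) (a 1 1) (a 2 2) (a 3 3) (a 4 4)
  · rwa [mkColor_self ha] at this
  -- `allColors` tests transitivity before the circles are chosen, hence on the color with its
  -- diagonal erased. Erasing circles preserves transitivity.
  · let a₀ : Color := fun i j => if i = j then false else a i j
    have ha₀ : ∀ i j, a₀ i j = a₀ j i := fun i j => by
      simp only [a₀, ha i j, eq_comm (a := i)]
    have e := mkColor_self ha₀
    change mkColor false false false false false (a 0 1) (a 0 2) (a 1 2) (a 0 3) (a 1 3) (a 2 3)
      (a 0 4) (a 1 4) (a 2 4) (a 3 4) = a₀ at e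
    rw [e]
    rw [transB_iff] at ht ⊢
    intro i j k hij hjk
    simp only [a₀] at *
    split_ifs at * with h₁ h₂ h₃
    · exact Or.inl ‹_›
    · exact ht i j k hij hjk

/-- Only soundness of the search is needed. It compares the diagonal and the pairs $i<j$; symmetry
gives the other entries, and distinct images on five points give a permutation. -/
theorem exists_perm_of_isoB {a b a' b' : Color} (ha : ∀ i j, a i j = a j i)
    (hb : ∀ i j, b i j = b j i) (ha' : ∀ i j, a' i j = a' j i) (hb' : ∀ i j, b' i j = b' j i)
    (h : isoB a b a' b' = true) :
    ∃ σ : Equiv.Perm (Fin 5), ∀ i j, a (σ i) (σ j) = a' i j ∧ b (σ i) (σ j) = b' i j := by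
  simp only [isoB, any5_iff, conj_iff, compat, compat₁, neg_iff, eq5_iff, same_iff] at h
  obtain ⟨s₀, ⟨h00, k00⟩, s₁, ⟨h11, k11⟩, ⟨n01, h01, k01⟩, s₂, ⟨h22, k22⟩, ⟨n02, h02, k02⟩,
    ⟨n12, h12, k12⟩, s₃, ⟨h33, k33⟩, ⟨n03, h03, k03⟩, ⟨n13, h13, k13⟩, ⟨n23, h23, k23⟩, s₄,
    ⟨h44, k44⟩, ⟨n04, h04, k04⟩, ⟨n14, h14, k14⟩, ⟨n24, h24, k24⟩, ⟨n34, h34, k34⟩⟩ := h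
  let s : Fin 5 → Fin 5 := ![s₀, s₁, s₂, s₃, s₄]
  have hs : ∀ i j, i < j → s i ≠ s j ∧ a (s i) (s j) = a' i j ∧ b (s i) (s j) = b' i j := by
    intro i j hij
    fin_cases i <;> fin_cases j <;> first
      | exact absurd hij (by decide)
      | exact ⟨n01, h01, k01⟩ | exact ⟨n02, h02, k02⟩ | exact ⟨n12, h12, k12⟩
      | exact ⟨n03, h03, k03⟩ | exact ⟨n13, h13, k13⟩ | exact ⟨n23, h23, k23⟩
      | exact ⟨n04, h04, k04⟩ | exact ⟨n14, h14, k14⟩ | exact ⟨n24, h24, k24⟩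
      | exact ⟨n34, h34, k34⟩
  have hd : ∀ i, a (s i) (s i) = a' i i ∧ b (s i) (s i) = b' i i := by
    intro i
    fin_cases i
    exacts [⟨h00, k00⟩, ⟨h11, k11⟩, ⟨h22, k22⟩, ⟨h33, k33⟩, ⟨h44, k44⟩]
  have hinj : Function.Injective s := by
    intro i j hij
    rcases lt_trichotomy i j with h | h | h
    · exact absurd hij (hs i j h).1
    · exact h
    · exact absurd hij.symm (hs j i h).1
  refine ⟨Equiv.ofBijective s (Finite.injective_iff_bijective.mp hinj), fun i j => ?_⟩
  simp only [Equiv.ofBijective_apply]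
  rcases lt_trichotomy i j with h | rfl | h
  · exact (hs i j h).2
  · exact hd i
  · rw [ha, hb, ha' i, hb' i]
    exact (hs j i h).2

/-! ### Invariance of the checks under relabelling -/

/-- Relabelling of a color. -/
def permC (σ : Equiv.Perm (Fin 5)) (a : Color) : Color := fun i j => a (σ i) (σ j)

theorem all5_perm (σ : Equiv.Perm (Fin 5)) {f g : Fin 5 → Bool} (h : ∀ i, f i = g (σ i)) :
    all5 f = all5 g := by
  rw [Bool.eq_iff_iff, all5_iff, all5_iff,
    ← σ.forall_congr_right (q := fun i => g i = true)]
  simp only [h]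

theorem any5_perm (σ : Equiv.Perm (Fin 5)) {f g : Fin 5 → Bool} (h : ∀ i, f i = g (σ i)) :
    any5 f = any5 g := by
  rw [Bool.eq_iff_iff, any5_iff, any5_iff,
    ← σ.exists_congr_right (q := fun i => g i = true)]
  simp only [h]

theorem count5_perm (σ : Equiv.Perm (Fin 5)) {f g : Fin 5 → Bool} (h : ∀ i, f i = g (σ i)) :
    count5 f = count5 g := by
  rw [count5_eq, count5_eq, ← Equiv.sum_comp σ fun i => num (g i)]
  simp only [h]

theorem eq5_perm (σ : Equiv.Perm (Fin 5)) (i j : Fin 5) : eq5 i j = eq5 (σ i) (σ j) := by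
  rw [Bool.eq_iff_iff, eq5_iff, eq5_iff, σ.injective.eq_iff]

theorem rel_perm (σ : Equiv.Perm (Fin 5)) (a : Color) (i j : Fin 5) :
    rel (permC σ a) i j = rel a (σ i) (σ j) := by
  rw [rel, rel, eq5_perm σ]; rfl

/-- The check is assembled from quantifiers and counts over all vertices, each of which can be
reindexed by `σ`. The proof descends through the formula one connective at a time; reducible
transparency stops it from unfolding these connectives. -/
theorem singleB_perm (σ : Equiv.Perm (Fin 5)) (a : Color) : singleB (permC σ a) = singleB a := by
  unfold singleB
  repeat' first
    | with_reducible exact rel_perm σ _ _ _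
    | with_reducible refine all5_perm σ fun _ => ?_
    | with_reducible refine any5_perm σ fun _ => ?_
    | with_reducible refine count5_perm σ fun _ => ?_
    | with_reducible refine congrArg neg ?_
    | with_reducible refine congrArg₂ conj ?_ ?_
    | with_reducible refine congrArg₂ Nat.beq ?_ ?_
    | rfl

theorem mixedB_perm (σ : Equiv.Perm (Fin 5)) (a b : Color) :
    mixedB (permC σ a) (permC σ b) = mixedB a b := by
  unfold mixedB circlingB traceTwoB polygonB dumbbellB fullyEdgedB fullyEdgedAtB dumbbellAtB
    circledB fullB
  repeat' first
    | with_reducible exact rel_perm σ _ _ _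
    | with_reducible exact eq5_perm σ _ _
    | with_reducible refine all5_perm σ fun _ => ?_
    | with_reducible refine any5_perm σ fun _ => ?_
    | with_reducible refine count5_perm σ fun _ => ?_
    | with_reducible refine congrArg neg ?_
    | with_reducible refine congrArg₂ conj ?_ ?_
    | with_reducible refine congrArg₂ disj ?_ ?_
    | with_reducible refine congrArg₂ imp ?_ ?_
    | with_reducible refine congrArg₂ same ?_ ?_
    | with_reducible refine congrArg₂ Nat.beq ?_ ?_
    | with_reducible refine congrArg₂ Nat.ble ?_ ?_
    | with_reducible refine congrArg₂ HAdd.hAdd ?_ ?_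
    | rfl

theorem mkColor_symm (c₀ c₁ c₂ c₃ c₄ e₀₁ e₀₂ e₁₂ e₀₃ e₁₃ e₂₃ e₀₄ e₁₄ e₂₄ e₃₄ : Bool) (i j : Fin 5) :
    mkColor c₀ c₁ c₂ c₃ c₄ e₀₁ e₀₂ e₁₂ e₀₃ e₁₃ e₂₃ e₀₄ e₁₄ e₂₄ e₃₄ i j =
      mkColor c₀ c₁ c₂ c₃ c₄ e₀₁ e₀₂ e₁₂ e₀₃ e₁₃ e₂₃ e₀₄ e₁₄ e₂₄ e₃₄ j i := by
  fin_cases i <;> fin_cases j <;> rfl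

theorem reps_symm {r : Color} (hr : r ∈ reps) (i j : Fin 5) : r i j = r j i := by
  simp only [reps, List.mem_append, List.mem_map, List.mem_cons, List.not_mem_nil, or_false] at hr
  rcases hr with (((⟨c, _, rfl⟩ | ⟨c, _, rfl⟩) | ⟨c, _, rfl⟩) | ⟨c, _, rfl⟩) | rfl | rfl <;>
    exact mkColor_symm ..

theorem toColor_symm {M : Matrix (Fin 5) (Fin 5) ℕ} (h : M.IsSymm) (i j : Fin 5) :
    toColor M i j = toColor M j i := by
  rw [toColor, toColor, h.apply]

theorem oneColor_isSymm (C : Finset (Fin 5)) (S : List (Finset (Fin 5))) :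
    (oneColor C S).IsSymm := by
  ext i j
  simp only [oneColor, Matrix.transpose_apply, Matrix.of_apply, eq_comm (a := j), and_comm]
  split_ifs <;> simp_all

theorem isSymm_of_mem_diagrams {d : ZWMatrix 5} (hd : d ∈ diagrams) :
    d.1.IsSymm ∧ d.2.IsSymm := by
  simp only [diagrams, List.mem_cons, List.not_mem_nil, or_false] at hd
  rcases hd with h | h | h | h | h | h | h | h | h | h | h | h | h | h | h | h | h | h | h | h |
    h | h | h | h | h | h | h | h | h | h | h <;>
  · rw [h]
    exact ⟨oneColor_isSymm _ _, oneColor_isSymm _ _⟩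

theorem exists_diagram_of_checks {a b : Color} (ha : ∀ i j, a i j = a j i)
    (hb : ∀ i j, b i j = b j i) (hta : transB a = true) (htb : transB b = true)
    (hsa : singleB a = true) (hsb : singleB b = true) (hab : mixedB a b = true)
    (hba : mixedB b a = true) :
    ∃ d ∈ diagrams, ∃ σ : Equiv.Perm (Fin 5),
      (a = permC σ (toColor d.1) ∧ b = permC σ (toColor d.2)) ∨
      (a = permC σ (toColor d.2) ∧ b = permC σ (toColor d.1)) := by
  have henum := enumeration_eq
  rw [enumeration, freezeList_eq] at henum
  swap
  · intro p hp
    obtain ⟨d, hd, rfl⟩ := List.mem_map.mp hp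
    exact ⟨toColor_symm (isSymm_of_mem_diagrams hd).1, toColor_symm (isSymm_of_mem_diagrams hd).2⟩
  -- The enumeration is used first with `a` in the role of the running color, which gives a
  -- relabelling `σ` of `a` into `reps`. It is used again with the color `b` relabelled by the same
  -- `σ`.
  have h₁ := allColors_apply henum ha hta
  rw [imp_iff, conj_iff] at h₁
  obtain ⟨r, hr, hiso⟩ := List.any_eq_true.mp (h₁ hsa).1
  obtain ⟨σ, hσ⟩ := exists_perm_of_isoB ha ha (reps_symm hr) (reps_symm hr) hiso
  obtain rfl : r = permC σ a := funext fun i => funext fun j => ((hσ i j).1).symm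
  have h₂ := allColors_apply henum (a := permC σ b) (fun i j => hb _ _) (by
    rw [transB_iff] at htb ⊢
    intro i j k h h'
    exact (htb _ _ _ h h').imp (fun h => σ.injective h) id)
  rw [imp_iff, conj_iff] at h₂
  have h₃ := List.all_eq_true.mp (h₂ ((singleB_perm σ b).trans hsb)).2 _ hr
  simp only [imp_iff, mixedB_perm] at h₃
  obtain ⟨p, hp, hl⟩ := List.any_eq_true.mp (h₃ hab hba)
  obtain ⟨d, hd, rfl⟩ := List.mem_map.mp hp
  have hd₁ := toColor_symm (isSymm_of_mem_diagrams hd).1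
  have hd₂ := toColor_symm (isSymm_of_mem_diagrams hd).2
  -- A match of the relabelled pair is transported back by undoing `σ`.
  have key : ∀ {c c' : Color}, (∀ i j, c i j = c j i) → (∀ i j, c' i j = c' j i) →
      isoB c c' (permC σ a) (permC σ b) = true →
      ∃ τ : Equiv.Perm (Fin 5), a = permC τ c ∧ b = permC τ c' := by
    intro c c' hc hc' h
    obtain ⟨τ, hτ⟩ := exists_perm_of_isoB hc hc' (fun i j => ha _ _) (fun i j => hb _ _) h
    refine ⟨σ.symm.trans τ, ?_, ?_⟩ <;> funext i j
    · simpa [permC] using (hτ (σ.symm i) (σ.symm j)).1.symm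
    · simpa [permC] using (hτ (σ.symm i) (σ.symm j)).2.symm
  rw [disj_iff] at hl
  rcases hl with hl | hl
  · obtain ⟨τ, h⟩ := key hd₁ hd₂ hl
    exact ⟨d, hd, τ, Or.inl h⟩
  · obtain ⟨τ, h⟩ := key hd₂ hd₁ hl
    exact ⟨d, hd, τ, Or.inr h⟩

/-- The checks hold for every listed diagram. -/
def diagramsChecked : Bool :=
  freezeList (diagrams.map fun d => (toColor d.1, toColor d.2)) fun l =>
  l.all fun d => transB d.1 ∧ᵇ transB d.2 ∧ᵇ singleB d.1 ∧ᵇ singleB d.2 ∧ᵇ mixedB d.1 d.2 ∧ᵇ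
    mixedB d.2 d.1

theorem diagramsChecked_eq : diagramsChecked = true := by decide +kernel

theorem checks_of_mem_diagrams {d : ZWMatrix 5} (hd : d ∈ diagrams) :
    transB (toColor d.1) = true ∧ transB (toColor d.2) = true ∧ singleB (toColor d.1) = true ∧
    singleB (toColor d.2) = true ∧ mixedB (toColor d.1) (toColor d.2) = true ∧
    mixedB (toColor d.2) (toColor d.1) = true := by
  have h := diagramsChecked_eq
  rw [diagramsChecked, freezeList_eq] at h
  · simpa only [conj_iff] using List.all_eq_true.mp h _ (List.mem_map_of_mem hd)
  · intro p hp
    obtain ⟨d, hd, rfl⟩ := List.mem_map.mp hp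
    exact ⟨toColor_symm (isSymm_of_mem_diagrams hd).1, toColor_symm (isSymm_of_mem_diagrams hd).2⟩

/-! ### Inequivalence of the listed diagrams -/

/-- Two numbers that separate the listed diagrams. -/
def diagramInvariant (P : ZWMatrix 5) : ℕ × ℕ :=
  ((∑ i, ∑ j, P.1 i j) * ∑ i, ∑ j, P.2 i j, ∑ i, ∑ j, ∑ k, P.1 i k * P.2 j k)

theorem sum_sum_submatrix (M : Matrix (Fin 5) (Fin 5) ℕ) (σ : Equiv.Perm (Fin 5)) :
    ∑ i, ∑ j, M.submatrix σ σ i j = ∑ i, ∑ j, M i j := by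
  simp only [Matrix.submatrix_apply]
  rw [← Equiv.sum_comp σ fun i => ∑ j, M i j]
  exact Finset.sum_congr rfl fun i _ => Equiv.sum_comp σ fun j => M (σ i) j

theorem sum_mul_submatrix (M M' : Matrix (Fin 5) (Fin 5) ℕ) (σ : Equiv.Perm (Fin 5)) :
    ∑ i, ∑ j, ∑ k, M.submatrix σ σ i k * M'.submatrix σ σ j k =
      ∑ i, ∑ j, ∑ k, M i k * M' j k := by
  simp only [Matrix.submatrix_apply]
  rw [← Equiv.sum_comp σ fun i => ∑ j, ∑ k, M i k * M' j k]
  refine Finset.sum_congr rfl fun i _ => ?_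
  rw [← Equiv.sum_comp σ fun j => ∑ k, M (σ i) k * M' j k]
  exact Finset.sum_congr rfl fun j _ => Equiv.sum_comp σ fun k => M (σ i) k * M' (σ j) k

/-- The first number is the product of the two entry totals. The second is the sum over vertices $k$
of the product of the $k$-th column sums of the two colors. Both are symmetric in the colors and
independent of the labelling. -/
theorem SameDiagram.diagramInvariant_eq {P Q : ZWMatrix 5} (h : SameDiagram P Q) :
    diagramInvariant P = diagramInvariant Q := by
  obtain ⟨σ, h | h⟩ := h
  · simp only [diagramInvariant, h.1, h.2, sum_sum_submatrix, sum_mul_submatrix]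
  · simp only [diagramInvariant, h.1, h.2, sum_sum_submatrix, sum_mul_submatrix]
    refine Prod.ext (mul_comm _ _) ?_
    simp only [mul_comm (P.2 _ _)]
    exact Finset.sum_comm

theorem diagrams_pairwise_invariant :
    diagrams.Pairwise fun D D' => diagramInvariant D ≠ diagramInvariant D' := by
  have h : (diagrams.map diagramInvariant).Nodup := by decide +kernel
  rw [List.nodup_iff_pairwise_ne, List.pairwise_map] at h
  exact h

/-! ### Connected components of matrices satisfying the first rule of triangle -/

section Components

variable {N : ℕ} {M : Matrix (Fin N) (Fin N) ℕ}

/-- Transitivity of the strokes, for symmetric binary matrices. -/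
def StrokeTrans (M : Matrix (Fin N) (Fin N) ℕ) : Prop :=
  ∀ i j k, M i j = 1 → M j k = 1 → i = k ∨ M i k = 1

/-- A triangle with exactly two strokes is precisely a failure of transitivity. The rule speaks of
$i<j<k$ only, so symmetry is used to sort the three vertices. -/
theorem ruleTriangle₁_iff (h : IsSymmBinary M) : RuleTriangle₁ M ↔ StrokeTrans M := by
  have hs : ∀ i j, M i j = M j i := fun i j => (h.1.apply i j).symm
  constructor
  · intro h3 i j k hij hjk
    by_contra! hne
    obtain ⟨hik, hM⟩ := hne
    have hM0 : M i k = 0 := (h.2 i k).resolve_right hM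
    have hij' : i ≠ j := by rintro rfl; exact hM hjk
    have hjk' : j ≠ k := by rintro rfl; exact hM hij
    have e1 := hs i j
    have e2 := hs j k
    have e3 := hs i k
    rcases lt_or_gt_of_ne hij' with h1 | h1 <;> rcases lt_or_gt_of_ne hjk' with h2 | h2 <;>
      rcases lt_or_gt_of_ne hik with h4 | h4
    · have := h3 i j k h1 h2; omega
    · exact absurd (h1.trans h2) h4.asymm
    · have := h3 i k j h4 h2; omega
    · have := h3 k i j h4 h1; omega
    · have := h3 j i k h1 h4; omega
    · have := h3 j k i h2 h4; omega
    · exact absurd (h2.trans h1) h4.asymm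
    · have := h3 k j i h2 h1; omega
  · intro ht i j k hij hjk h2
    have e1 := hs i j
    have e2 := hs j k
    have e3 := hs i k
    have a1 := ht i j k
    have a2 := ht j k i
    have a3 := ht k i j
    have n1 := hij.ne'
    have n2 := hjk.ne'
    have n3 := (hij.trans hjk).ne
    rcases h.2 i j with h1 | h1 <;> rcases h.2 j k with h2 | h2 <;> rcases h.2 k i with h3 | h3 <;>
      omega

/-- The vertices equal or adjacent to `i`. -/
def block (M : Matrix (Fin N) (Fin N) ℕ) (i : Fin N) : Finset (Fin N) :=
  Finset.univ.filter fun j => i = j ∨ M i j = 1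

theorem mem_block {i j : Fin N} : j ∈ block M i ↔ i = j ∨ M i j = 1 := by simp [block]

theorem self_mem_block (i : Fin N) : i ∈ block M i := mem_block.2 (Or.inl rfl)

theorem mem_block_symm (h : IsSymmBinary M) {i j : Fin N} (hj : j ∈ block M i) :
    i ∈ block M j := by
  rw [mem_block] at *
  rwa [← h.1.apply, eq_comm]

theorem mem_block_trans (ht : StrokeTrans M) {i j k : Fin N} (hj : j ∈ block M i)
    (hk : k ∈ block M j) : k ∈ block M i := by
  rw [mem_block] at *
  rcases hj with rfl | hj
  · exact hk
  · rcases hk with rfl | hk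
    · exact Or.inr hj
    · exact ht i j k hj hk

theorem block_eq (h : IsSymmBinary M) (ht : StrokeTrans M) {i j : Fin N} (hj : j ∈ block M i) :
    block M j = block M i := by
  ext k
  exact ⟨mem_block_trans ht hj, mem_block_trans ht (mem_block_symm h hj)⟩

theorem stroke_of_mem_block (h : IsSymmBinary M) (ht : StrokeTrans M) {i j k : Fin N}
    (hj : j ∈ block M i) (hk : k ∈ block M i) (hjk : j ≠ k) : M j k = 1 :=
  (mem_block.1 (mem_block_trans ht (mem_block_symm h hj) hk)).resolve_left hjk

/-- A nonzero entry of a power is a walk, and transitivity collapses a walk to equality or to one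
stroke. -/
theorem sum_pow_pos_iff (h : IsSymmBinary M) (ht : StrokeTrans M) {i j : Fin N} :
    0 < (∑ k ∈ Finset.range N, M ^ k) i j ↔ j ∈ block M i := by
  rw [Matrix.sum_apply, mem_block]
  constructor
  · intro hpos
    obtain ⟨k, -, hk⟩ := Finset.exists_ne_zero_of_sum_ne_zero hpos.ne'
    clear hpos
    induction k generalizing j with
    | zero =>
      left
      by_contra hij
      exact hk (by simp [hij])
    | succ k ih =>
      rw [pow_succ, Matrix.mul_apply] at hk
      obtain ⟨l, -, hl⟩ := Finset.exists_ne_zero_of_sum_ne_zero hk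
      have h1 := (h.2 l j).resolve_left (right_ne_zero_of_mul hl)
      rcases ih (left_ne_zero_of_mul hl) with rfl | h2
      · exact Or.inr h1
      · exact ht i l j h2 h1
  · intro hij
    -- Exponents 0 and 1 suffice; two distinct indices force $N\ge2$, so that exponent 1 is within
    -- the range.
    have hex : ∃ k ∈ Finset.range N, 0 < (M ^ k) i j := by
      by_cases hne : i = j
      · subst hne
        exact ⟨0, Finset.mem_range.2 i.pos, by simp⟩
      · refine ⟨1, Finset.mem_range.2 ?_, by simp [hij.resolve_left hne]⟩
        by_contra hN
        exact hne (Fin.ext (by omega))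
    obtain ⟨k, hk, hpos⟩ := hex
    exact hpos.trans_le (Finset.single_le_sum (f := fun k => (M ^ k) i j)
      (fun _ _ => Nat.zero_le _) hk)

theorem isConnComp_iff [NeZero N] (h : IsSymmBinary M) (ht : StrokeTrans M)
    {I : Finset (Fin N)} : IsConnComp M I ↔ ∃ i, I = block M i := by
  simp only [IsConnComp, sum_pow_pos_iff h ht]
  constructor
  · intro hI
    have hne : I.Nonempty := by
      rw [Finset.nonempty_iff_ne_empty]
      rintro rfl
      -- The empty set satisfies the positivity condition vacuously, but a singleton is a larger
      -- such set. This requires $N\neq0$.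
      have := hI.le_of_ge (y := {0}) (by simp [self_mem_block]) (by simp)
      simp at this
    obtain ⟨i, hi⟩ := hne
    refine ⟨i, le_antisymm (fun j hj => hI.prop i hi j hj) ?_⟩
    refine hI.le_of_ge (fun j hj k hk => ?_) (fun j hj => hI.prop i hi j hj)
    rwa [block_eq h ht hj]
  · rintro ⟨i, rfl⟩
    refine ⟨fun j hj k hk => by rwa [block_eq h ht hj], fun J hJ hle j hj => ?_⟩
    exact hJ i (hle (self_mem_block i)) j hj

/-! ### Counting circles and strokes -/

theorem circles_eq_card (h : IsSymmBinary M) (K : Finset (Fin N)) :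
    circles M K = (K.filter fun i => M i i = 1).card := by
  rw [circles, Finset.card_filter]
  refine Finset.sum_congr rfl fun i _ => ?_
  rcases h.2 i i with h | h <;> simp [h]

theorem circles_eq_zero_iff (h : IsSymmBinary M) {K : Finset (Fin N)} :
    circles M K = 0 ↔ ∀ i ∈ K, M i i ≠ 1 := by
  rw [circles_eq_card h, Finset.card_eq_zero, Finset.filter_eq_empty_iff]

theorem circles_le_card (h : IsSymmBinary M) (K : Finset (Fin N)) : circles M K ≤ K.card := by
  rw [circles_eq_card h]
  exact Finset.card_filter_le _ _

theorem circles_eq_card_iff (h : IsSymmBinary M) {K : Finset (Fin N)} :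
    circles M K = K.card ↔ ∀ i ∈ K, M i i = 1 := by
  rw [circles_eq_card h, Finset.card_filter_eq_iff]

/-- The left side is the numerical form in which the fully edged rule is stated. On the right it
says that the circled vertices of `I` are exactly those of `K`. -/
theorem circles_eq_circles_iff (h : IsSymmBinary M) {K I : Finset (Fin N)} (hK : K ⊆ I) :
    (circles M I = circles M K ∧ circles M K = K.card) ↔
      ∀ z, (z ∈ I ∧ M z z = 1) ↔ z ∈ K := by
  rw [circles_eq_card_iff h]
  constructor
  · rintro ⟨h1, h2⟩ z
    rw [circles_eq_card h, circles_eq_card h] at h1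
    have h3 := Finset.eq_of_subset_of_card_le (Finset.filter_subset_filter (fun i => M i i = 1) hK)
      h1.le
    refine ⟨fun hz => ?_, fun hz => ⟨hK hz, h2 z hz⟩⟩
    have : z ∈ I.filter fun i => M i i = 1 := Finset.mem_filter.2 hz
    rw [← h3] at this
    exact (Finset.mem_filter.1 this).1
  · intro hz
    refine ⟨?_, fun i hi => ((hz i).2 hi).2⟩
    rw [circles_eq_card h, circles_eq_card h]
    congr 1
    ext z
    simp only [Finset.mem_filter]
    exact ⟨fun hh => ⟨(hz z).1 hh, hh.2⟩, fun hh => ⟨hK hh.1, hh.2⟩⟩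

theorem card_strokePairs (K : Finset (Fin N)) :
    ((K ×ˢ K).filter fun p => p.1 < p.2).card = K.card.choose 2 := by
  induction K using Finset.induction_on_max with
  | empty => rfl
  | insert a s ha ih =>
    have hnot : a ∉ s := fun h => lt_irrefl _ (ha a h)
    have : ((insert a s ×ˢ insert a s).filter fun p : Fin N × Fin N => p.1 < p.2) =
        ((s ×ˢ s).filter fun p => p.1 < p.2) ∪ s.image fun x => (x, a) := by
      ext ⟨x, y⟩
      simp only [Finset.mem_filter, Finset.mem_product, Finset.mem_insert, Finset.mem_union,
        Finset.mem_image, Prod.mk.injEq]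
      constructor
      · rintro ⟨⟨rfl | hx, rfl | hy⟩, hlt⟩
        · exact absurd hlt (lt_irrefl _)
        · exact absurd hlt (ha y hy).asymm
        · exact Or.inr ⟨x, hx, rfl, rfl⟩
        · exact Or.inl ⟨⟨hx, hy⟩, hlt⟩
      · rintro (⟨⟨hx, hy⟩, hlt⟩ | ⟨x, hx, rfl, rfl⟩)
        · exact ⟨⟨Or.inr hx, Or.inr hy⟩, hlt⟩
        · exact ⟨⟨Or.inr hx, Or.inl rfl⟩, ha x hx⟩
    rw [this, Finset.card_union_of_disjoint, ih, Finset.card_image_of_injective _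
      (fun x y h => (Prod.mk.inj h).1), Finset.card_insert_of_notMem hnot, Nat.choose_succ_succ',
      Nat.choose_one_right, add_comm]
    rw [Finset.disjoint_left]
    rintro ⟨x, y⟩ h1 h2
    simp only [Finset.mem_filter, Finset.mem_product, Finset.mem_image, Prod.mk.injEq] at h1 h2
    obtain ⟨_, _, _, rfl⟩ := h2
    exact hnot h1.1.2

theorem strokes_le_choose (h : IsSymmBinary M) (K : Finset (Fin N)) :
    strokes M K ≤ K.card.choose 2 := by
  rw [strokes, ← card_strokePairs, Finset.card_eq_sum_ones]
  exact Finset.sum_le_sum fun p _ => by rcases h.2 p.1 p.2 with h | h <;> omega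

theorem strokes_eq_choose_iff (h : IsSymmBinary M) {K : Finset (Fin N)} :
    strokes M K = K.card.choose 2 ↔ ∀ i ∈ K, ∀ j ∈ K, i ≠ j → M i j = 1 := by
  rw [strokes, ← card_strokePairs, Finset.card_eq_sum_ones,
    Finset.sum_eq_sum_iff_of_le fun p _ => by rcases h.2 p.1 p.2 with h | h <;> omega]
  simp only [Finset.mem_filter, Finset.mem_product, Prod.forall, and_imp]
  constructor
  · intro hp i hi j hj hij
    rcases lt_or_gt_of_ne hij with hlt | hlt
    · exact hp i j hi hj hlt
    · rw [← h.1.apply]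
      exact hp j i hj hi hlt
  · intro hp i j hi hj hlt
    exact hp i hi j hj hlt.ne

/-- Each factor is at most its maximum, so the product is maximal only if both factors are. The
bound $2\le|K|$ keeps both maxima positive. For sizes 2, 3 and 4 the maximal products are the
constants 2, 9 and 24 of the rules. -/
theorem circles_mul_strokes_iff (h : IsSymmBinary M) {K : Finset (Fin N)} (hK : 2 ≤ K.card) :
    circles M K * strokes M K = K.card * K.card.choose 2 ↔
      (∀ i ∈ K, M i i = 1) ∧ ∀ i ∈ K, ∀ j ∈ K, i ≠ j → M i j = 1 := by
  rw [← circles_eq_card_iff h, ← strokes_eq_choose_iff h]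
  have h1 := circles_le_card h K
  have h2 := strokes_le_choose h K
  have h3 : 0 < K.card.choose 2 := Nat.choose_pos hK
  constructor
  · intro he
    by_contra hne
    rw [not_and_or] at hne
    have : circles M K * strokes M K < K.card * K.card.choose 2 := by
      rcases hne with hne | hne
      · exact Nat.mul_lt_mul_of_lt_of_le (lt_of_le_of_ne h1 hne) h2 h3
      · exact Nat.mul_lt_mul_of_le_of_lt h1 (lt_of_le_of_ne h2 hne) (by omega)
    omega
  · rintro ⟨h4, h5⟩
    rw [h4, h5]

/-- The rule of trace-0 principal minors follows from the rule of column sums. -/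
theorem ruleMinors_of_columnSums (h : IsSymmBinary M) (ht : StrokeTrans M)
    (hc : ∀ j, ∑ i, M i j ≠ 1) : RuleMinors M := by
  intro I hI hsum
  rw [← Finset.sum_product' I Iᶜ fun i j => M i j] at hsum
  obtain ⟨⟨i, j⟩, hp, hne⟩ := Finset.exists_ne_zero_of_sum_ne_zero
    (show ∑ x ∈ I ×ˢ Iᶜ, M x.1 x.2 ≠ 0 by omega)
  simp only [Finset.mem_product, Finset.mem_compl] at hp hne
  have hij : M i j = 1 := (h.2 i j).resolve_left hne
  have huniq : ∀ q ∈ I ×ˢ Iᶜ, q ≠ (i, j) → M q.1 q.2 = 0 := by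
    intro q hq hqne
    by_contra hq0
    have := Finset.add_le_sum (f := fun x : Fin N × Fin N => M x.1 x.2)
      (fun _ _ => Nat.zero_le _) (Finset.mem_product.2 ⟨hp.1, Finset.mem_compl.2 hp.2⟩) hq hqne.symm
    simp only at this
    omega
  -- The single outgoing stroke is the only entry in the column of its uncircled end `i`. Another
  -- neighbour `k` of `i` would give a second outgoing stroke: from `k` to `j` by transitivity if
  -- `k` is in `I`, and from `i` to `k` otherwise.
  apply hc i
  rw [Finset.sum_eq_single j]
  · rw [h.1.apply, hij]
  · intro k _ hkj
    by_contra hk0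
    have hki : M k i = 1 := (h.2 k i).resolve_left hk0
    have hki' : k ≠ i := by rintro rfl; exact hk0 (hI _ hp.1)
    by_cases hk : k ∈ I
    · have := huniq (k, j) (by simp [hk, hp.2]) (by simp [hki'])
      have h2 := ht k i j hki hij
      simp only at this
      rcases h2 with h2 | h2 <;> omega
    · have := huniq (i, k) (by simp [hk, hp.1]) (by simp [hkj])
      rw [← h.1.apply] at hki
      simp only at this
      omega
  · simp

end Components

/-! ### The rules and the boolean checks -/

section Checks

variable {M A B : Matrix (Fin 5) (Fin 5) ℕ}

theorem same_iff_iff {p q : Bool} : same p q = true ↔ (p = true ↔ q = true) := by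
  rw [same_iff, Bool.eq_iff_iff]

theorem natBeq_iff {m n : ℕ} : Nat.beq m n = true ↔ m = n := by
  simp

theorem toColor_iff {i j : Fin 5} : toColor M i j = true ↔ M i j = 1 :=
  natBeq_iff

theorem rel_toColor_iff {i j : Fin 5} : rel (toColor M) i j = true ↔ j ∈ block M i := by
  rw [rel, disj_iff, eq5_iff, toColor_iff, mem_block]

theorem count5_eq_card {f : Fin 5 → Bool} {K : Finset (Fin 5)} (h : ∀ i, f i = true ↔ i ∈ K) :
    count5 f = K.card := by
  simp only [count5_eq, num_eq, h]
  simp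

theorem count5_rel {i : Fin 5} : count5 (rel (toColor M) i) = (block M i).card :=
  count5_eq_card fun _ => rel_toColor_iff

theorem num_toColor (h : IsSymmBinary M) (i j : Fin 5) : num (toColor M i j) = M i j := by
  simp only [num_eq, toColor_iff]
  rcases h.2 i j with h | h <;> simp [h]

theorem count5_trace (h : IsSymmBinary M) : (count5 fun i => toColor M i i) = M.trace := by
  simp only [count5_eq, num_toColor h]
  rfl

theorem transB_toColor : transB (toColor M) = true ↔ StrokeTrans M := by
  simp only [transB_iff, toColor_iff, StrokeTrans]

theorem singleRules_iff (h : IsSymmBinary M) :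
    SingleRules M ↔ transB (toColor M) = true ∧ singleB (toColor M) = true := by
  have hcol : ∀ j, count5 (toColor M j) = ∑ i, M i j := fun j => by
    simp only [count5_eq, num_toColor h]
    exact Finset.sum_congr rfl fun i _ => h.1.apply _ _
  have hcirc : ∀ i, (count5 fun j => conj (rel (toColor M) i j) (toColor M j j)) =
      circles M (block M i) := fun i => by
    rw [circles_eq_card h]
    refine count5_eq_card fun j => ?_
    rw [conj_iff, rel_toColor_iff, toColor_iff, Finset.mem_filter]
  simp only [singleB, conj_iff, neg_iff, all5_iff, any5_iff, natBeq_iff, hcol, hcirc,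
    count5_trace h, toColor_iff, transB_toColor, SingleRules, RuleColumnSums, RuleTrace,
    ruleTriangle₁_iff h]
  have hzero : (¬ ∀ j, ∑ i, M i j = 0) ↔ ∃ i j, M i j = 1 := by
    push Not
    constructor
    · rintro ⟨j, hj⟩
      obtain ⟨i, -, hi⟩ := Finset.exists_ne_zero_of_sum_ne_zero hj
      exact ⟨i, j, (h.2 i j).resolve_left hi⟩
    · rintro ⟨i, j, hij⟩
      refine ⟨j, fun h0 => ?_⟩
      have := (Finset.sum_eq_zero_iff.1 h0) i (Finset.mem_univ i)
      omega
  rw [hzero]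
  constructor
  · rintro ⟨⟨h1, h2⟩, h3, h4, h5, h6⟩
    exact ⟨h4, h3, h1, fun i => h5 _ ((isConnComp_iff h h4).2 ⟨i, rfl⟩), h2⟩
  · rintro ⟨h4, h3, h1, h5, h2⟩
    refine ⟨⟨h1, h2⟩, h3, h4, fun I hI => ?_, ruleMinors_of_columnSums h h4 h1⟩
    obtain ⟨i, rfl⟩ := (isConnComp_iff h h4).1 hI
    exact h5 i

theorem circlingB_iff (hA : IsSymmBinary A) (hB : IsSymmBinary B) :
    circlingB (toColor A) (toColor B) = true ↔ RuleCircling A B := by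
  simp only [circlingB, all5_iff, imp_iff, same_iff_iff, toColor_iff, RuleCircling]
  constructor
  · intro h i j _ he
    have h1 := Nat.eq_one_of_mul_eq_one_right he
    rw [h1, one_mul] at he
    have h2 := h i j h1
    rcases hB.2 i i with h3 | h3 <;> rcases hB.2 j j with h4 | h4 <;> omega
  · intro h i j hij
    have key : ∀ i j, i < j → A i j = 1 → (B i i = 1 ↔ B j j = 1) := by
      intro i j hlt hij
      have := h i j hlt
      rw [hij, one_mul] at this
      rcases hB.2 i i with h3 | h3 <;> rcases hB.2 j j with h4 | h4 <;> omega
    rcases lt_trichotomy i j with hlt | rfl | hlt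
    · exact key i j hlt hij
    · rfl
    · exact (key j i hlt (by rwa [hA.1.apply])).symm

theorem traceTwoB_iff (hA : IsSymmBinary A) (hB : IsSymmBinary B) :
    traceTwoB (toColor A) (toColor B) = true ↔ RuleTraceTwo A B := by
  simp only [traceTwoB, imp_iff, all5_iff, natBeq_iff, count5_trace hA, disj_iff, eq5_iff,
    neg_iff, conj_iff, toColor_iff, RuleTraceTwo]
  refine imp_congr_right fun _ => forall_congr' fun i => forall_congr' fun j => ?_
  rcases hA.2 i j with h3 | h3 <;> rcases hB.2 i j with h4 | h4 <;> simp [h3, h4]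
  grind

theorem forall_block_stroke (hB : IsSymmBinary B) (hb : StrokeTrans B) (i : Fin 5) :
    ∀ j ∈ block B i, ∀ k ∈ block B i, j ≠ k → B j k = 1 :=
  fun _ hj _ hk hjk => stroke_of_mem_block hB hb hj hk hjk

/-- Components are blocks, hence always fully stroked. Clause (i) is clause (iv) for a single
component. In (iv) only the smallest union matters, that of the blocks meeting `K`: every admissible
union contains it, and all of `K` is already circled in it. -/
theorem ruleFullyEdged_iff (hA : IsSymmBinary A) (hB : IsSymmBinary B) (ha : StrokeTrans A)
    (hb : StrokeTrans B) :
    RuleFullyEdged A B ↔ ∀ i, 3 ≤ (block A i).card → (∀ z ∈ block A i, A z z ≠ 1) →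
      (∀ y, (∀ x ∈ block A i, (block A i).erase x ⊆ block B y →
        ¬ ∀ z, (z ∈ block B y ∧ B z z = 1) ↔ z ∈ (block A i).erase x) ∧
        ¬ (block A i ⊆ block B y ∧ (block A i).card + 1 = (block B y).card ∧
          ∀ z ∈ block B y, B z z ≠ 1)) ∧
      ¬ ∀ z, ((∃ x ∈ block A i, z ∈ block B x) ∧ B z z = 1) ↔ z ∈ block A i := by
  simp only [RuleFullyEdged, isConnComp_iff hA ha, isConnComp_iff hB hb, forall_exists_index,
    forall_eq_apply_imp_iff]
  refine forall_congr' fun i => imp_congr_right fun _ => ?_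
  rw [← circles_eq_zero_iff hA]
  constructor
  · intro h h0
    obtain ⟨h1, h2, h3, h4⟩ := h (forall_block_stroke hA ha i) h0
    refine ⟨fun y => ⟨fun x hx hsub hz => ?_, fun hJ => ?_⟩, fun hz => ?_⟩
    · exact h2 x hx y hsub ((circles_eq_circles_iff hB hsub).2 hz)
    · exact h3 y hJ.1 hJ.2.1 ⟨forall_block_stroke hB hb y, (circles_eq_zero_iff hB).2 hJ.2.2⟩
    · have hsub : block A i ⊆ ((block A i).image (block B)).biUnion id := fun x hx =>
        Finset.mem_biUnion.2 ⟨block B x, Finset.mem_image_of_mem _ hx, self_mem_block x⟩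
      refine h4 ((block A i).image (block B)) ?_ hsub ((circles_eq_circles_iff hB hsub).2 ?_)
      · intro I hI
        obtain ⟨x, -, rfl⟩ := Finset.mem_image.1 hI
        exact ⟨x, rfl⟩
      · simpa using hz
  · intro h _ h0
    obtain ⟨h1, h4⟩ := h h0
    have hU : ∀ F : Finset (Finset (Fin 5)), (∀ I ∈ F, ∃ y, I = block B y) →
        block A i ⊆ F.biUnion id → ¬ (circles B (F.biUnion id) = circles B (block A i) ∧
          circles B (block A i) = (block A i).card) := by
      intro F hF hsub hc
      rw [circles_eq_circles_iff hB hsub] at hc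
      refine h4 fun z => ⟨?_, fun hz => ⟨⟨z, hz, self_mem_block z⟩, ((hc z).2 hz).2⟩⟩
      rintro ⟨⟨x, hx, hzx⟩, hz⟩
      obtain ⟨I, hI, hxI⟩ := Finset.mem_biUnion.1 (hsub hx)
      obtain ⟨y, rfl⟩ := hF I hI
      exact (hc z).1 ⟨Finset.mem_biUnion.2 ⟨_, hI, mem_block_trans hb hxI hzx⟩, hz⟩
    refine ⟨fun y hsub hc => ?_, fun x hx y hsub hc => ?_, fun y hsub hcard hJ => ?_, hU⟩
    · refine hU {block B y} (by simp) (by simpa using hsub) (by simpa using hc)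
    · exact (h1 y).1 x hx hsub ((circles_eq_circles_iff hB hsub).1 hc)
    · exact (h1 y).2 ⟨hsub, hcard, (circles_eq_zero_iff hB).1 hJ.2⟩

theorem fullyEdgedB_iff (hA : IsSymmBinary A) (hB : IsSymmBinary B) (ha : StrokeTrans A)
    (hb : StrokeTrans B) :
    fullyEdgedB (toColor A) (toColor B) = true ↔ RuleFullyEdged A B := by
  rw [ruleFullyEdged_iff hA hB ha hb]
  simp only [fullyEdgedB, fullyEdgedAtB, all5_iff, any5_iff, imp_iff, conj_iff, neg_iff, same_iff_iff,
    eq5_iff, natBeq_iff, Nat.ble_eq, count5_rel, rel_toColor_iff,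
    toColor_iff, Finset.subset_iff, Finset.mem_erase, and_imp, ne_eq]
  -- The two sides now differ only in the order of hypotheses and conjuncts.
  simp only [and_comm, imp.swap, and_left_comm]

theorem circledB_iff {K : Fin 5 → Bool} {K' : Finset (Fin 5)} (hK : ∀ i, K i = true ↔ i ∈ K') :
    circledB (toColor M) K = true ↔ ∀ i ∈ K', M i i = 1 := by
  simp only [circledB, all5_iff, imp_iff, hK, toColor_iff]

theorem fullB_iff {K : Fin 5 → Bool} {K' : Finset (Fin 5)} (hK : ∀ i, K i = true ↔ i ∈ K') :
    fullB (toColor M) K = true ↔ ∀ i ∈ K', ∀ j ∈ K', i ≠ j → M i j = 1 := by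
  simp only [fullB, all5_iff, imp_iff, conj_iff, hK, rel_toColor_iff, mem_block, and_imp, ne_eq,
    or_iff_not_imp_left]
  exact forall_congr' fun i => forall_comm

theorem polygonB_iff (hA : IsSymmBinary A) (hB : IsSymmBinary B) (ha : StrokeTrans A) :
    polygonB (toColor A) (toColor B) = true ↔ RuleTriangle₂ A B ∧ RuleQuadrilateral A B := by
  simp only [polygonB, RuleTriangle₂, RuleQuadrilateral, isConnComp_iff hA ha, forall_exists_index,
    forall_eq_apply_imp_iff, all5_iff, imp_iff, conj_iff, natBeq_iff, count5_trace hA,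
    count5_rel, circledB_iff (fun _ => rel_toColor_iff), fullB_iff (fun _ => rel_toColor_iff),
    Nat.ble_eq]
  rw [← forall_and]
  refine forall_congr' fun i => ?_
  have hfull := forall_block_stroke hA ha i
  have h3 : (block A i).card = 3 →
      ((circles A (block A i) * strokes A (block A i) = 9 ↔ ∀ j ∈ block A i, A j j = 1) ∧
      (circles B (block A i) * strokes B (block A i) = 9 ↔
        (∀ j ∈ block A i, B j j = 1) ∧
          ∀ j ∈ block A i, ∀ k ∈ block A i, j ≠ k → B j k = 1)) := fun hc => by
    have hA' := circles_mul_strokes_iff hA (K := block A i) (by omega)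
    have hB' := circles_mul_strokes_iff hB (K := block A i) (by omega)
    rw [hc] at hA' hB'
    exact ⟨hA'.trans (and_iff_left hfull), hB'⟩
  have h4 : (block A i).card = 4 →
      ((circles A (block A i) * strokes A (block A i) = 24 ↔ ∀ j ∈ block A i, A j j = 1) ∧
      (strokes B (block A i) = 6 ↔
          ∀ j ∈ block A i, ∀ k ∈ block A i, j ≠ k → B j k = 1)) := fun hc => by
    have hA' := circles_mul_strokes_iff hA (K := block A i) (by omega)
    have hB' := strokes_eq_choose_iff hB (K := block A i)
    rw [hc] at hA' hB'
    exact ⟨hA'.trans (and_iff_left hfull), hB'⟩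
  constructor
  · intro h
    refine ⟨fun hc hca hcb => ?_, fun hc hca hcb => ?_⟩
    · exact (h ((h3 hc).1.1 hca)).1 ⟨hc, (h3 hc).2.1 hcb⟩
    · exact (h ((h4 hc).1.1 hca)).2 ⟨hc, (h4 hc).2.1 hcb⟩
  · rintro ⟨h5, h6⟩ hca
    exact ⟨fun h => h5 h.1 ((h3 h.1).1.2 hca) ((h3 h.1).2.2 h.2),
      fun h => h6 h.1 ((h4 h.1).1.2 hca) ((h4 h.1).2.2 h.2)⟩

theorem dumbbellB_iff (hA : IsSymmBinary A) (hB : IsSymmBinary B) (ha : StrokeTrans A) :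
    dumbbellB (toColor A) (toColor B) = true ↔ RuleDumbbells A B := by
  simp only [dumbbellB, dumbbellAtB, RuleDumbbells, isConnComp_iff hA ha, forall_exists_index,
    all5_iff, imp_iff, conj_iff, neg_iff, natBeq_iff, count5_trace hA,
    count5_trace hB, count5_rel, circledB_iff (fun _ => rel_toColor_iff),
    fullB_iff (fun _ => rel_toColor_iff), Nat.ble_eq, rel_toColor_iff]
  have h2 : ∀ i, ((block A i).card = 2 ∧ (∀ j ∈ block A i, A j j = 1) ∧
      (∀ j ∈ block A i, B j j = 1) ∧ ∀ j ∈ block A i, ∀ k ∈ block A i, j ≠ k → B j k = 1) ↔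
      ((block A i).card = 2 ∧ circles A (block A i) * strokes A (block A i) = 2 ∧
        circles B (block A i) * strokes B (block A i) = 2) := fun i => by
    refine and_congr_right fun hc => ?_
    have hA' := circles_mul_strokes_iff hA (K := block A i) (by omega)
    have hB' := circles_mul_strokes_iff hB (K := block A i) (by omega)
    rw [hc] at hA' hB'
    rw [show 2 = 2 * Nat.choose 2 2 from rfl, hA', hB', and_iff_left (forall_block_stroke hA ha i)]
  simp only [h2]
  constructor
  · intro h _ _ i hi j hj hne hd
    subst hi hj
    refine h i (hd _ (Or.inl rfl)) j ⟨fun hij => hne ?_, hd _ (Or.inr rfl)⟩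
    exact (block_eq hA ha hij).symm
  · intro h i hi j hj
    refine h _ _ i rfl j rfl (fun he => hj.1 (he ▸ self_mem_block j)) ?_
    rintro K (rfl | rfl)
    · exact hi
    · exact hj.2

theorem mixedB_iff (hA : IsSymmBinary A) (hB : IsSymmBinary B) (ha : StrokeTrans A)
    (hb : StrokeTrans B) : mixedB (toColor A) (toColor B) = true ↔ MixedRules A B := by
  simp only [mixedB, conj_iff, circlingB_iff hA hB, traceTwoB_iff hA hB, polygonB_iff hA hB ha,
    dumbbellB_iff hA hB ha, fullyEdgedB_iff hA hB ha hb, MixedRules]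
  tauto

/-- The eleven rules in terms of the boolean checks. -/
theorem satisfiesRules_iff {P : ZWMatrix 5} (h₁ : IsSymmBinary P.1) (h₂ : IsSymmBinary P.2) :
    SatisfiesRules P ↔ transB (toColor P.1) = true ∧ transB (toColor P.2) = true ∧
      singleB (toColor P.1) = true ∧ singleB (toColor P.2) = true ∧
      mixedB (toColor P.1) (toColor P.2) = true ∧ mixedB (toColor P.2) (toColor P.1) = true := by
  rw [SatisfiesRules, singleRules_iff h₁, singleRules_iff h₂]
  constructor
  · rintro ⟨⟨t₁, s₁⟩, ⟨t₂, s₂⟩, m₁, m₂⟩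
    have t₁' := transB_toColor.1 t₁
    have t₂' := transB_toColor.1 t₂
    exact ⟨t₁, t₂, s₁, s₂, (mixedB_iff h₁ h₂ t₁' t₂').2 m₁, (mixedB_iff h₂ h₁ t₂' t₁').2 m₂⟩
  · rintro ⟨t₁, t₂, s₁, s₂, m₁, m₂⟩
    have t₁' := transB_toColor.1 t₁
    have t₂' := transB_toColor.1 t₂
    exact ⟨⟨t₁, s₁⟩, ⟨t₂, s₂⟩, (mixedB_iff h₁ h₂ t₁' t₂').1 m₁, (mixedB_iff h₂ h₁ t₂' t₁').1 m₂⟩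

/-! ### From the checks to the classification -/

theorem oneColor_isSymmBinary (C : Finset (Fin 5)) (S : List (Finset (Fin 5))) :
    IsSymmBinary (oneColor C S) := by
  refine ⟨oneColor_isSymm C S, fun i j => ?_⟩
  simp only [oneColor, Matrix.of_apply]
  split_ifs <;> simp

theorem isSymmBinary_of_mem_diagrams {d : ZWMatrix 5} (hd : d ∈ diagrams) :
    IsSymmBinary d.1 ∧ IsSymmBinary d.2 := by
  simp only [diagrams, List.mem_cons, List.not_mem_nil, or_false] at hd
  rcases hd with h | h | h | h | h | h | h | h | h | h | h | h | h | h | h | h | h | h | h | h |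
    h | h | h | h | h | h | h | h | h | h | h <;>
  · rw [h]
    exact ⟨oneColor_isSymmBinary _ _, oneColor_isSymmBinary _ _⟩

theorem eq_submatrix_of_toColor {M M' : Matrix (Fin 5) (Fin 5) ℕ} (h : IsSymmBinary M)
    (h' : IsSymmBinary M') {σ : Equiv.Perm (Fin 5)} (hc : toColor M' = permC σ (toColor M)) :
    M' = M.submatrix σ σ := by
  ext i j
  have := congrArg num (congrFun (congrFun hc i) j)
  rwa [permC, num_toColor h, num_toColor h'] at this

theorem IsSymmBinary.submatrix {M : Matrix (Fin 5) (Fin 5) ℕ} (h : IsSymmBinary M)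
    (σ : Equiv.Perm (Fin 5)) : IsSymmBinary (M.submatrix σ σ) :=
  ⟨h.1.submatrix σ, fun i j => h.2 (σ i) (σ j)⟩

theorem toColor_submatrix (M : Matrix (Fin 5) (Fin 5) ℕ) (σ : Equiv.Perm (Fin 5)) :
    toColor (M.submatrix σ σ) = permC σ (toColor M) := rfl

theorem transB_perm (σ : Equiv.Perm (Fin 5)) {a : Color} (h : transB a = true) :
    transB (permC σ a) = true := by
  rw [transB_iff] at h ⊢
  intro i j k h₁ h₂
  exact (h _ _ _ h₁ h₂).imp (fun h => σ.injective h) id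

theorem rules_iff_sameDiagram (P : ZWMatrix 5) :
    (IsSymmBinary P.1 ∧ IsSymmBinary P.2 ∧ SatisfiesRules P) ↔
      ∃ D ∈ diagrams, SameDiagram D P := by
  constructor
  · rintro ⟨h₁, h₂, h⟩
    obtain ⟨t₁, t₂, s₁, s₂, m₁, m₂⟩ := (satisfiesRules_iff h₁ h₂).1 h
    obtain ⟨d, hd, σ, hσ⟩ := exists_diagram_of_checks (toColor_symm h₁.1) (toColor_symm h₂.1)
      t₁ t₂ s₁ s₂ m₁ m₂
    obtain ⟨d₁, d₂⟩ := isSymmBinary_of_mem_diagrams hd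
    refine ⟨d, hd, σ, hσ.imp (fun h => ?_) fun h => ?_⟩
    · exact ⟨eq_submatrix_of_toColor d₁ h₁ h.1, eq_submatrix_of_toColor d₂ h₂ h.2⟩
    · exact ⟨eq_submatrix_of_toColor d₂ h₁ h.1, eq_submatrix_of_toColor d₁ h₂ h.2⟩
  · rintro ⟨d, hd, σ, hσ⟩
    obtain ⟨d₁, d₂⟩ := isSymmBinary_of_mem_diagrams hd
    obtain ⟨t₁, t₂, s₁, s₂, m₁, m₂⟩ := checks_of_mem_diagrams hd
    rcases hσ with ⟨e₁, e₂⟩ | ⟨e₁, e₂⟩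
    · have h₁ : IsSymmBinary P.1 := e₁ ▸ d₁.submatrix σ
      have h₂ : IsSymmBinary P.2 := e₂ ▸ d₂.submatrix σ
      refine ⟨h₁, h₂, (satisfiesRules_iff h₁ h₂).2 ?_⟩
      simp only [e₁, e₂, toColor_submatrix, singleB_perm, mixedB_perm]
      exact ⟨transB_perm σ t₁, transB_perm σ t₂, s₁, s₂, m₁, m₂⟩
    · have h₁ : IsSymmBinary P.1 := e₁ ▸ d₂.submatrix σ
      have h₂ : IsSymmBinary P.2 := e₂ ▸ d₁.submatrix σ
      refine ⟨h₁, h₂, (satisfiesRules_iff h₁ h₂).2 ?_⟩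
      simp only [e₁, e₂, toColor_submatrix, singleB_perm, mixedB_perm]
      exact ⟨transB_perm σ t₂, transB_perm σ t₁, s₂, s₁, m₂, m₁⟩

end Checks

open Filter Topology

/-! ### Limits along a singular sequence -/

/-- The equations of a singular sequence of size `R` together with its rescaled limits, in a form
that is symmetric in the two colors. -/
structure LimitData {N : ℕ} (Γ : Fin N → ℝ) (Λ Λ' : ℂ) (R : ℕ → ℝ) (z w : ℕ → Fin N → ℂ)
    (Z W : ℕ → Fin N → Fin N → ℂ) (zt wt : Fin N → ℂ) (Zt Wt : Fin N → Fin N → ℂ) : Prop where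
  Γ_ne : ∀ k, Γ k ≠ 0
  Λ_ne : Λ ≠ 0
  Λ'_ne : Λ' ≠ 0
  R_lim : Tendsto R atTop atTop
  z_eq : ∀ n k, Λ * z n k = ∑ j, (Γ j : ℂ) * Z n j k
  w_eq : ∀ n k, Λ' * w n k = ∑ j, (Γ j : ℂ) * W n j k
  Z_mul : ∀ n j k, j ≠ k → Z n j k * (w n k - w n j) = 1
  W_mul : ∀ n j k, j ≠ k → W n j k * (z n k - z n j) = 1
  Z_anti : ∀ n j k, Z n j k = -Z n k j
  W_anti : ∀ n j k, W n j k = -W n k j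
  z_lim : ∀ k, Tendsto (fun n => (R n : ℂ)⁻¹ * z n k) atTop (𝓝 (zt k))
  w_lim : ∀ k, Tendsto (fun n => (R n : ℂ)⁻¹ * w n k) atTop (𝓝 (wt k))
  Z_lim : ∀ j k, Tendsto (fun n => (R n : ℂ)⁻¹ * Z n j k) atTop (𝓝 (Zt j k))
  W_lim : ∀ j k, Tendsto (fun n => (R n : ℂ)⁻¹ * W n j k) atTop (𝓝 (Wt j k))
  z_nonzero : (∃ k, zt k ≠ 0) ∨ ∃ j k, j ≠ k ∧ Zt j k ≠ 0
  w_nonzero : (∃ k, wt k ≠ 0) ∨ ∃ j k, j ≠ k ∧ Wt j k ≠ 0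

namespace LimitData

variable {N : ℕ} {Γ : Fin N → ℝ} {Λ Λ' : ℂ} {R : ℕ → ℝ} {z w : ℕ → Fin N → ℂ}
  {Z W : ℕ → Fin N → Fin N → ℂ} {zt wt : Fin N → ℂ} {Zt Wt : Fin N → Fin N → ℂ}

/-- Exchange of the colors. -/
theorem swap (D : LimitData Γ Λ Λ' R z w Z W zt wt Zt Wt) :
    LimitData Γ Λ' Λ R w z W Z wt zt Wt Zt :=
  ⟨D.Γ_ne, D.Λ'_ne, D.Λ_ne, D.R_lim, D.w_eq, D.z_eq, D.W_mul, D.Z_mul, D.W_anti, D.Z_anti,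
    D.w_lim, D.z_lim, D.W_lim, D.Z_lim, D.w_nonzero, D.z_nonzero⟩

variable (D : LimitData Γ Λ Λ' R z w Z W zt wt Zt Wt)
include D

theorem R_ne : ∀ᶠ n in atTop, (R n : ℂ) ≠ 0 := by
  filter_upwards [D.R_lim.eventually_gt_atTop 0] with n hn
  exact_mod_cast hn.ne'

theorem R_inv_lim : Tendsto (fun n => (R n : ℂ)⁻¹) atTop (𝓝 0) := by
  have h : Tendsto (fun n => (R n)⁻¹) atTop (𝓝 0) := tendsto_inv_atTop_zero.comp D.R_lim
  have := (Complex.continuous_ofReal.tendsto 0).comp h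
  simpa [Function.comp_def] using this

theorem Zt_anti (j k : Fin N) : Zt j k = -Zt k j := by
  refine tendsto_nhds_unique (D.Z_lim j k) ((D.Z_lim k j).neg.congr fun n => ?_)
  rw [D.Z_anti n j k, mul_neg]

theorem Zt_self (j : Fin N) : Zt j j = 0 := self_eq_neg.1 (D.Zt_anti j j)

theorem zt_eq (k : Fin N) : Λ * zt k = ∑ j, (Γ j : ℂ) * Zt j k := by
  have h1 := (D.z_lim k).const_mul Λ
  have h2 : Tendsto (fun n => ∑ j, (Γ j : ℂ) * ((R n : ℂ)⁻¹ * Z n j k)) atTop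
      (𝓝 (∑ j, (Γ j : ℂ) * Zt j k)) :=
    tendsto_finsetSum _ fun j _ => (D.Z_lim j k).const_mul _
  refine tendsto_nhds_unique h1 (h2.congr fun n => ?_)
  rw [mul_left_comm, D.z_eq, Finset.mul_sum]
  exact Finset.sum_congr rfl fun j _ => by ring

/-- The interactions inside `K` cancel in the sum of the equations over `K`. -/
theorem sum_z_eq (K : Finset (Fin N)) (n : ℕ) :
    Λ * ∑ k ∈ K, (Γ k : ℂ) * z n k =
      ∑ j ∈ Kᶜ, (Γ j : ℂ) * ∑ k ∈ K, (Γ k : ℂ) * Z n j k := by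
  have h1 : Λ * ∑ k ∈ K, (Γ k : ℂ) * z n k =
      ∑ j, (Γ j : ℂ) * ∑ k ∈ K, (Γ k : ℂ) * Z n j k := by
    simp only [Finset.mul_sum]
    rw [Finset.sum_comm]
    refine Finset.sum_congr rfl fun k _ => ?_
    rw [mul_left_comm, D.z_eq, Finset.mul_sum]
    exact Finset.sum_congr rfl fun j _ => by ring
  have h2 : ∑ j ∈ K, (Γ j : ℂ) * ∑ k ∈ K, (Γ k : ℂ) * Z n j k = 0 := by
    -- Exchanging the two indices turns the antisymmetric double sum into its negative.
    refine self_eq_neg.1 ?_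
    simp only [Finset.mul_sum]
    nth_rewrite 1 [Finset.sum_comm]
    rw [← Finset.sum_neg_distrib]
    refine Finset.sum_congr rfl fun k _ => ?_
    rw [← Finset.sum_neg_distrib]
    refine Finset.sum_congr rfl fun j _ => ?_
    rw [D.Z_anti n j k]
    ring
  rw [h1, ← Finset.sum_add_sum_compl K, h2, zero_add]

/-- The weighted sum of the limits vanishes over a set without outgoing strokes. -/
theorem sum_zt_eq_zero {K : Finset (Fin N)} (hK : ∀ k ∈ K, ∀ j ∉ K, Zt j k = 0) :
    ∑ k ∈ K, (Γ k : ℂ) * zt k = 0 := by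
  have h1 : Tendsto (fun n => Λ * ∑ k ∈ K, (Γ k : ℂ) * ((R n : ℂ)⁻¹ * z n k)) atTop
      (𝓝 (Λ * ∑ k ∈ K, (Γ k : ℂ) * zt k)) :=
    (tendsto_finsetSum _ fun k _ => (D.z_lim k).const_mul _).const_mul _
  have h2 : Tendsto (fun n => ∑ j ∈ Kᶜ, (Γ j : ℂ) * ∑ k ∈ K, (Γ k : ℂ) * ((R n : ℂ)⁻¹ * Z n j k))
      atTop (𝓝 (∑ j ∈ Kᶜ, (Γ j : ℂ) * ∑ k ∈ K, (Γ k : ℂ) * Zt j k)) :=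
    tendsto_finsetSum _ fun j _ =>
      (tendsto_finsetSum _ fun k _ => (D.Z_lim j k).const_mul _).const_mul _
  have h3 := tendsto_nhds_unique h1 (h2.congr fun n => ?_)
  · rw [Finset.sum_eq_zero (s := Kᶜ)] at h3
    · exact (mul_eq_zero.1 h3).resolve_left D.Λ_ne
    · intro j hj
      rw [Finset.sum_eq_zero, mul_zero]
      intro k hk
      rw [hK k hk j (Finset.mem_compl.1 hj), mul_zero]
  · have := congrArg (fun x => (R n : ℂ)⁻¹ * x) (D.sum_z_eq K n)
    simp only [Finset.mul_sum] at this ⊢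
    refine (Eq.trans ?_ this.symm).trans ?_ <;>
    · refine Finset.sum_congr rfl fun j _ => ?_
      first
        | ring1
        | exact Finset.sum_congr rfl fun k _ => by ring

/-- Rule of circling: a stroke of one color joins vertices that are close in the other color. -/
theorem wt_eq_of_stroke {j k : Fin N} (h : Zt j k ≠ 0) : wt j = wt k := by
  have hjk : j ≠ k := by rintro rfl; exact h (D.Zt_self j)
  have h1 := (D.Z_lim j k).mul ((D.w_lim k).sub (D.w_lim j))
  have h2 := D.R_inv_lim.mul D.R_inv_lim
  have h3 := tendsto_nhds_unique h1 (h2.congr fun n => ?_)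
  · rw [mul_zero] at h3
    exact (sub_eq_zero.1 ((mul_eq_zero.1 h3).resolve_left h)).symm
  · linear_combination -(R n : ℂ)⁻¹ * (R n : ℂ)⁻¹ * D.Z_mul n j k hjk

/-- Here $w_k-w_j$ is the inverse of $Z_{jk}$, so a stroke makes it exactly of order $1/R$. -/
theorem tendsto_of_stroke {j k : Fin N} (h : Zt j k ≠ 0) :
    Tendsto (fun n => (R n : ℂ) * (w n k - w n j)) atTop (𝓝 (Zt j k)⁻¹) := by
  have hjk : j ≠ k := by rintro rfl; exact h (D.Zt_self j)
  refine ((D.Z_lim j k).inv₀ h).congr fun n => ?_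
  rw [mul_inv, inv_inv, eq_inv_of_mul_eq_one_right (D.Z_mul n j k hjk)]

/-- Since $Z_{jk}/R$ converges, two distinct vertices are never closer than order $1/R$: otherwise a
product that is constantly 1 would tend to 0. -/
theorem not_tendsto_zero {j k : Fin N} (hjk : j ≠ k) :
    ¬ Tendsto (fun n => (R n : ℂ) * (w n k - w n j)) atTop (𝓝 0) := by
  intro h
  have h1 := (D.Z_lim j k).mul h
  rw [mul_zero] at h1
  have h2 : Tendsto (fun _ : ℕ => (1 : ℂ)) atTop (𝓝 0) := by
    refine h1.congr' ?_
    filter_upwards [D.R_ne] with n hn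
    have := D.Z_mul n j k hjk
    field_simp
    linear_combination this
  exact one_ne_zero (tendsto_nhds_unique tendsto_const_nhds h2)

/-- Two strokes keep $R(w_k-w_i)$ convergent as the sum of two convergent differences. Its product
with $Z_{ik}/R$ is 1, so the latter cannot tend to 0. -/
theorem stroke_trans {i j k : Fin N} (hik : i ≠ k) (hij : Zt i j ≠ 0) (hjk : Zt j k ≠ 0) :
    Zt i k ≠ 0 := by
  intro h0
  have h1 := (D.tendsto_of_stroke hij).add (D.tendsto_of_stroke hjk)
  have h2 := (D.Z_lim i k).mul h1
  rw [h0, zero_mul] at h2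
  have h3 : Tendsto (fun _ : ℕ => (1 : ℂ)) atTop (𝓝 0) := by
    refine h2.congr' ?_
    filter_upwards [D.R_ne] with n hn
    have := D.Z_mul n i k hik
    field_simp
    linear_combination this
  exact one_ne_zero (tendsto_nhds_unique tendsto_const_nhds h3)

/-! ### Clusters and the moment identity -/

/-- A cluster of `w` of vanishing total vorticity has a small moment in `z`. -/
theorem tendsto_sum_cluster {K : Finset (Fin N)} {c : ℂ} (hK : ∀ k ∈ K, wt k = c)
    (hK' : ∀ j ∉ K, wt j ≠ c) (h0 : ∑ k ∈ K, (Γ k : ℂ) = 0) :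
    Tendsto (fun n => (R n : ℂ) * ∑ k ∈ K, (Γ k : ℂ) * z n k) atTop (𝓝 0) := by
  have hZ : ∀ j ∉ K, ∀ k ∈ K,
      Tendsto (fun n => (R n : ℂ) * Z n j k) atTop (𝓝 (c - wt j)⁻¹) := by
    intro j hj k hk
    have hne : wt k - wt j ≠ 0 := sub_ne_zero.2 (hK k hk ▸ (hK' j hj).symm)
    have hjk : j ≠ k := by rintro rfl; exact hj hk
    have h1 := ((D.w_lim k).sub (D.w_lim j)).inv₀ hne
    rw [hK k hk] at h1
    refine h1.congr fun n => ?_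
    rw [← mul_sub, mul_inv, inv_inv, eq_inv_of_mul_eq_one_left (D.Z_mul n j k hjk)]
  have h1 : Tendsto (fun n => ∑ j ∈ Kᶜ, (Γ j : ℂ) * ∑ k ∈ K, (Γ k : ℂ) * ((R n : ℂ) * Z n j k))
      atTop (𝓝 (∑ j ∈ Kᶜ, (Γ j : ℂ) * ∑ k ∈ K, (Γ k : ℂ) * (c - wt j)⁻¹)) :=
    tendsto_finsetSum _ fun j hj => (tendsto_finsetSum _ fun k hk =>
      (hZ j (Finset.mem_compl.1 hj) k hk).const_mul _).const_mul _
  -- The limit of $RZ_{jk}$ does not depend on $k$ in the cluster, so the total vorticity factors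
  -- out of the inner sum.
  have h2 : ∑ j ∈ Kᶜ, (Γ j : ℂ) * ∑ k ∈ K, (Γ k : ℂ) * (c - wt j)⁻¹ = 0 := by
    simp only [← Finset.sum_mul, h0, zero_mul, mul_zero, Finset.sum_const_zero]
  rw [h2] at h1
  have h3 := h1.const_mul Λ⁻¹
  rw [mul_zero] at h3
  refine h3.congr fun n => ?_
  have h4 : ∑ j ∈ Kᶜ, (Γ j : ℂ) * ∑ k ∈ K, (Γ k : ℂ) * ((R n : ℂ) * Z n j k) =
      (R n : ℂ) * ∑ j ∈ Kᶜ, (Γ j : ℂ) * ∑ k ∈ K, (Γ k : ℂ) * Z n j k := by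
    simp only [Finset.mul_sum]
    exact Finset.sum_congr rfl fun j _ => Finset.sum_congr rfl fun k _ => by ring
  have hΛ := D.Λ_ne
  rw [h4, ← D.sum_z_eq K n]
  field_simp

/-- The moment identity on a fully stroked component on which `z` clusters. -/
theorem exists_moment_limit {K : Finset (Fin N)} {c : ℂ} {b : Fin N} (hb : b ∈ K)
    (hz : ∀ k ∈ K, zt k = c) (hfull : ∀ j ∈ K, ∀ k ∈ K, j ≠ k → Zt j k ≠ 0)
    (hout : ∀ k ∈ K, ∀ j ∉ K, Zt j k = 0) :
    ∃ S, Tendsto (fun n => (R n : ℂ) * ∑ k ∈ K, (Γ k : ℂ) * (w n k - w n b)) atTop (𝓝 S) ∧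
      2 * (Λ * c * S) = (∑ k ∈ K, (Γ k : ℂ)) ^ 2 - ∑ k ∈ K, (Γ k : ℂ) ^ 2 := by
  classical
  -- For $k=b$ both sides are zero, by the convention that the inverse of 0 is 0.
  have hη : ∀ k ∈ K, Tendsto (fun n => (R n : ℂ) * (w n k - w n b)) atTop (𝓝 (Zt b k)⁻¹) := by
    intro k hk
    by_cases hkb : b = k
    · subst hkb
      simp [D.Zt_self]
    · exact D.tendsto_of_stroke (hfull b hb k hk hkb)
  -- The relation $Z_{jk}(w_k-w_j)=1$ in the limit, with positions measured from `b`.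
  have hdiff : ∀ j ∈ K, ∀ k ∈ K, Zt j k * ((Zt b k)⁻¹ - (Zt b j)⁻¹) = if j = k then 0 else 1 := by
    intro j hj k hk
    by_cases hjk : j = k
    · rw [hjk, D.Zt_self]
      simp
    · have h1 := (hη k hk).sub (hη j hj)
      have h2 := D.tendsto_of_stroke (hfull j hj k hk hjk)
      have h3 := tendsto_nhds_unique h1 (h2.congr fun n => by ring)
      rw [h3, if_neg hjk, mul_inv_cancel₀ (hfull j hj k hk hjk)]
  refine ⟨∑ k ∈ K, (Γ k : ℂ) * (Zt b k)⁻¹, ?_, ?_⟩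
  · have h1 : Tendsto (fun n => ∑ k ∈ K, (Γ k : ℂ) * ((R n : ℂ) * (w n k - w n b))) atTop
        (𝓝 (∑ k ∈ K, (Γ k : ℂ) * (Zt b k)⁻¹)) :=
      tendsto_finsetSum _ fun k hk => (hη k hk).const_mul _
    refine h1.congr fun n => ?_
    rw [Finset.mul_sum]
    exact Finset.sum_congr rfl fun k _ => by ring
  · have hc : ∀ k ∈ K, Λ * c = ∑ j ∈ K, (Γ j : ℂ) * Zt j k := by
      intro k hk
      rw [← hz k hk, D.zt_eq k]
      refine (Finset.sum_subset (Finset.subset_univ K) fun j _ hj => ?_).symm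
      rw [hout k hk j hj, mul_zero]
    have e1 : Λ * c * ∑ k ∈ K, (Γ k : ℂ) * (Zt b k)⁻¹ =
        ∑ k ∈ K, ∑ j ∈ K, (Γ k : ℂ) * (Γ j : ℂ) * (Zt j k * (Zt b k)⁻¹) := by
      rw [Finset.mul_sum]
      refine Finset.sum_congr rfl fun k hk => ?_
      rw [hc k hk, Finset.sum_mul]
      exact Finset.sum_congr rfl fun j _ => by ring
    -- The same double sum with its indices exchanged. Adding it to `e1` pairs the terms into the
    -- products of `hdiff`, each equal to 1 off the diagonal.
    have e2 : Λ * c * ∑ k ∈ K, (Γ k : ℂ) * (Zt b k)⁻¹ =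
        ∑ k ∈ K, ∑ j ∈ K, (Γ k : ℂ) * (Γ j : ℂ) * (-(Zt j k * (Zt b j)⁻¹)) := by
      rw [e1, Finset.sum_comm]
      refine Finset.sum_congr rfl fun k _ => Finset.sum_congr rfl fun j _ => ?_
      rw [D.Zt_anti k j]
      ring
    have e3 : (∑ k ∈ K, (Γ k : ℂ)) ^ 2 - ∑ k ∈ K, (Γ k : ℂ) ^ 2 =
        ∑ k ∈ K, ∑ j ∈ K, (Γ k : ℂ) * (Γ j : ℂ) * (if j = k then 0 else 1) := by
      rw [sq, Finset.sum_mul_sum, ← Finset.sum_sub_distrib]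
      refine Finset.sum_congr rfl fun k hk => ?_
      rw [sub_eq_iff_eq_add, ← Finset.sum_erase_add _ _ hk, ← Finset.sum_erase_add K _ hk,
        if_pos rfl, mul_zero, add_zero, ← sq]
      congr 1
      refine Finset.sum_congr rfl fun j hj => ?_
      rw [if_neg (Finset.ne_of_mem_erase hj), mul_one]
    rw [two_mul, e3]
    nth_rewrite 1 [e1]
    rw [e2, ← Finset.sum_add_distrib]
    refine Finset.sum_congr rfl fun k hk => ?_
    rw [← Finset.sum_add_distrib]
    refine Finset.sum_congr rfl fun j hj => ?_
    rw [← hdiff j hj k hk]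
    ring

/-- A sum of squares of nonzero real vorticities is positive; for complex ones it could vanish. -/
theorem sum_sq_ne_zero {K : Finset (Fin N)} (hK : K.Nonempty) :
    ∑ k ∈ K, (Γ k : ℂ) ^ 2 ≠ 0 := by
  have : 0 < ∑ k ∈ K, Γ k ^ 2 := Finset.sum_pos (fun k _ => sq_pos_of_ne_zero (D.Γ_ne k)) hK
  exact_mod_cast this.ne'

/-- With zero total vorticity the base point drops out of the moment, and the right side of the
identity reduces to minus the sum of squares. -/
theorem moment_limit_of_sum_eq_zero {K : Finset (Fin N)} {c : ℂ} (hK : K.Nonempty)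
    (hz : ∀ k ∈ K, zt k = c) (hfull : ∀ j ∈ K, ∀ k ∈ K, j ≠ k → Zt j k ≠ 0)
    (hout : ∀ k ∈ K, ∀ j ∉ K, Zt j k = 0) (h0 : ∑ k ∈ K, (Γ k : ℂ) = 0) :
    ∃ S, Tendsto (fun n => (R n : ℂ) * ∑ k ∈ K, (Γ k : ℂ) * w n k) atTop (𝓝 S) ∧
      2 * (Λ * c * S) = -∑ k ∈ K, (Γ k : ℂ) ^ 2 := by
  obtain ⟨b, hb⟩ := hK
  obtain ⟨S, hS, hL⟩ := D.exists_moment_limit hb hz hfull hout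
  refine ⟨S, hS.congr fun n => ?_, by rw [hL, h0]; ring⟩
  simp only [mul_sub, Finset.sum_sub_distrib, ← Finset.sum_mul, h0, zero_mul, sub_zero]

/-- Without circles $c=0$, which kills the left side of the moment identity. -/
theorem sq_sum_of_uncircled {K : Finset (Fin N)} (hK : K.Nonempty)
    (hz : ∀ k ∈ K, zt k = 0) (hfull : ∀ j ∈ K, ∀ k ∈ K, j ≠ k → Zt j k ≠ 0)
    (hout : ∀ k ∈ K, ∀ j ∉ K, Zt j k = 0) :
    (∑ k ∈ K, (Γ k : ℂ)) ^ 2 = ∑ k ∈ K, (Γ k : ℂ) ^ 2 := by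
  obtain ⟨b, hb⟩ := hK
  obtain ⟨S, -, hL⟩ := D.exists_moment_limit hb hz hfull hout
  linear_combination -hL

/-- Two vertices of opposite vorticities cannot have a small moment. -/
theorem not_tendsto_pair {i j : Fin N} (hij : i ≠ j) (h0 : (Γ i : ℂ) + Γ j = 0) :
    ¬ Tendsto (fun n => (R n : ℂ) * (Γ i * w n i + Γ j * w n j)) atTop (𝓝 0) := by
  intro h
  apply D.not_tendsto_zero hij
  have hΓ : (Γ j : ℂ) ≠ 0 := by exact_mod_cast D.Γ_ne j
  have h1 := h.const_mul (Γ j : ℂ)⁻¹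
  rw [mul_zero] at h1
  refine h1.congr fun n => ?_
  field_simp
  linear_combination (R n : ℂ) * w n i * h0

/-- The weighted sum of the limits over a set without outgoing strokes whose circled vertices are
those of `K`, all close to each other. -/
theorem sum_eq_zero_of_circled {U K : Finset (Fin N)} {c : ℂ}
    (hU : ∀ k ∈ U, ∀ j ∉ U, Zt j k = 0) (hUK : ∀ k, (k ∈ U ∧ zt k ≠ 0) ↔ k ∈ K)
    (hz : ∀ k ∈ K, zt k = c) (hK : K.Nonempty) : ∑ k ∈ K, (Γ k : ℂ) = 0 := by
  have h1 := D.sum_zt_eq_zero hU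
  have hsub : K ⊆ U := fun k hk => ((hUK k).2 hk).1
  rw [← Finset.sum_subset hsub fun k hk hk' => ?_,
    Finset.sum_congr rfl fun k hk => by rw [hz k hk], ← Finset.sum_mul] at h1
  · obtain ⟨b, hb⟩ := hK
    exact (mul_eq_zero.1 h1).resolve_right (hz b hb ▸ ((hUK b).2 hb).2)
  · by_contra hne
    exact hk' ((hUK k).1 ⟨hk, right_ne_zero_of_mul hne⟩)

end LimitData

/-! ### The eleven rules for singular sequences -/

/-- `M` is the adjacency matrix of the nonvanishing limits, circles being the diagonal entries. -/
structure IsColorOf (M : Matrix (Fin 5) (Fin 5) ℕ) (zt : Fin 5 → ℂ) (Zt : Fin 5 → Fin 5 → ℂ) :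
    Prop where
  bin : ∀ i j, M i j = 0 ∨ M i j = 1
  circ : ∀ i, M i i = 1 ↔ zt i ≠ 0
  stroke : ∀ i j, i ≠ j → (M i j = 1 ↔ Zt i j ≠ 0)

namespace LimitData

variable {Γ : Fin 5 → ℝ} {Λ Λ' : ℂ} {R : ℕ → ℝ} {z w : ℕ → Fin 5 → ℂ}
  {Z W : ℕ → Fin 5 → Fin 5 → ℂ} {zt wt : Fin 5 → ℂ} {Zt Wt : Fin 5 → Fin 5 → ℂ}
  {A B : Matrix (Fin 5) (Fin 5) ℕ}

variable (D : LimitData Γ Λ Λ' R z w Z W zt wt Zt Wt)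
include D

theorem isSymmBinary (hA : IsColorOf A zt Zt) : IsSymmBinary A := by
  refine ⟨Matrix.IsSymm.ext fun i j => ?_, hA.bin⟩
  by_cases hij : i = j
  · rw [hij]
  · have h : A i j = 1 ↔ A j i = 1 := by
      rw [hA.stroke i j hij, hA.stroke j i (Ne.symm hij), D.Zt_anti i j, neg_ne_zero]
    rcases hA.bin i j with h1 | h1 <;> rcases hA.bin j i with h2 | h2 <;> omega

theorem strokeTrans (hA : IsColorOf A zt Zt) : StrokeTrans A := by
  intro i j k hij hjk
  by_cases hik : i = k
  · exact Or.inl hik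
  · right
    by_cases h1 : i = j
    · rwa [h1]
    by_cases h2 : j = k
    · rwa [← h2]
    rw [hA.stroke i k hik]
    exact D.stroke_trans hik ((hA.stroke i j h1).1 hij) ((hA.stroke j k h2).1 hjk)

theorem wt_eq_of_adj (hA : IsColorOf A zt Zt) {i j : Fin 5} (h : A i j = 1) : wt i = wt j := by
  by_cases hij : i = j
  · rw [hij]
  · exact D.wt_eq_of_stroke ((hA.stroke i j hij).1 h)

theorem wt_eq_of_mem_block (hA : IsColorOf A zt Zt) {i j : Fin 5} (h : j ∈ block A i) :
    wt j = wt i := by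
  rcases mem_block.1 h with rfl | h
  · rfl
  · exact (D.wt_eq_of_adj hA h).symm

theorem Zt_eq_zero_of_block (hA : IsColorOf A zt Zt) {i : Fin 5} :
    ∀ k ∈ block A i, ∀ j ∉ block A i, Zt j k = 0 := by
  intro k hk j hj
  by_contra hne
  have hkj : k ≠ j := by rintro rfl; exact hj hk
  refine hj (mem_block_trans (D.strokeTrans hA) hk (mem_block.2 (Or.inr ?_)))
  rw [hA.stroke k j hkj, D.Zt_anti]
  exact neg_ne_zero.2 hne

theorem Zt_ne_zero_of_block (hA : IsColorOf A zt Zt) {i : Fin 5} :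
    ∀ j ∈ block A i, ∀ k ∈ block A i, j ≠ k → Zt j k ≠ 0 := fun j hj k hk hjk =>
  (hA.stroke j k hjk).1 (stroke_of_mem_block (D.isSymmBinary hA) (D.strokeTrans hA) hj hk hjk)

theorem eq_zero_of_sum_eq_zero {K : Finset (Fin 5)} {i : Fin 5} (hi : i ∈ K) {x : Fin 5 → ℂ}
    (hx : ∀ k ∈ K, k ≠ i → x k = 0) (h : ∑ k ∈ K, (Γ k : ℂ) * x k = 0) : x i = 0 := by
  rw [Finset.sum_eq_single_of_mem i hi fun k hk hki => by rw [hx k hk hki, mul_zero]] at h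
  exact (mul_eq_zero.1 h).resolve_left (by exact_mod_cast D.Γ_ne i)

/-- In the limit equation $\Lambda z_j=\sum_k\Gamma_kZ_{kj}$ a lone nonzero term, on either side,
cannot be balanced. The matrix is nonzero because some rescaled coordinate survives. -/
theorem ruleColumnSums (hA : IsColorOf A zt Zt) : RuleColumnSums A := by
  constructor
  · intro j hj
    obtain ⟨i, -, hi⟩ := Finset.exists_ne_zero_of_sum_ne_zero (show ∑ i, A i j ≠ 0 by omega)
    have hi1 : A i j = 1 := (hA.bin i j).resolve_left hi
    have hk : ∀ k, k ≠ i → A k j = 0 := by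
      rw [← Finset.sum_erase_add _ _ (Finset.mem_univ i), hi1, Nat.add_eq_right,
        Finset.sum_eq_zero_iff] at hj
      exact fun k hk => hj k (Finset.mem_erase.2 ⟨hk, Finset.mem_univ k⟩)
    have hZ : ∀ k, k ≠ i → Zt k j = 0 := by
      intro k hki
      by_cases hkj : k = j
      · rw [hkj, D.Zt_self]
      · by_contra hne
        have := (hA.stroke k j hkj).2 hne
        have := hk k hki
        omega
    by_cases hij : i = j
    · subst hij
      have h0 := D.zt_eq i
      rw [Finset.sum_eq_zero fun k _ => ?_] at h0
      · exact (hA.circ i).1 hi1 ((mul_eq_zero.1 h0).resolve_left D.Λ_ne)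
      · by_cases hki : k = i
        · rw [hki, D.Zt_self, mul_zero]
        · rw [hZ k hki, mul_zero]
    · have hz : zt j = 0 := by
        by_contra hne
        have := (hA.circ j).2 hne
        have := hk j (Ne.symm hij)
        omega
      have h0 := D.zt_eq j
      rw [hz, mul_zero] at h0
      exact (hA.stroke i j hij).1 hi1 (D.eq_zero_of_sum_eq_zero (x := fun k => Zt k j)
        (Finset.mem_univ i) (fun k _ hki => hZ k hki) h0.symm)
  · intro h0
    have h1 : ∀ i j, A i j = 0 := fun i j =>
      Finset.sum_eq_zero_iff.1 (h0 j) i (Finset.mem_univ i)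
    rcases D.z_nonzero with ⟨k, hk⟩ | ⟨j, k, hjk, hk⟩
    · have := (hA.circ k).2 hk
      have := h1 k k
      omega
    · have := (hA.stroke j k hjk).2 hk
      have := h1 j k
      omega

/-- A set without outgoing strokes does not have exactly one circle. -/
theorem circles_ne_one (hA : IsColorOf A zt Zt) {K : Finset (Fin 5)}
    (hK : ∀ k ∈ K, ∀ j ∉ K, Zt j k = 0) : circles A K ≠ 1 := by
  intro h1
  obtain ⟨i, hi, hi0⟩ := Finset.exists_ne_zero_of_sum_ne_zero (show ∑ i ∈ K, A i i ≠ 0 by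
    rw [circles] at h1; omega)
  have hi1 : A i i = 1 := (hA.bin i i).resolve_left hi0
  rw [circles, ← Finset.sum_erase_add _ _ hi, hi1, Nat.add_eq_right,
    Finset.sum_eq_zero_iff] at h1
  refine (hA.circ i).1 hi1 (D.eq_zero_of_sum_eq_zero hi (fun k hk hki => ?_) (D.sum_zt_eq_zero hK))
  by_contra hne
  have := (hA.circ k).2 hne
  have := h1 k (Finset.mem_erase.2 ⟨hki, hk⟩)
  omega

theorem singleRules (hA : IsColorOf A zt Zt) : SingleRules A := by
  have h := D.isSymmBinary hA
  have ht := D.strokeTrans hA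
  have hc := D.ruleColumnSums hA
  -- The trace and component rules are the same statement, for the whole vertex set and for one
  -- block: neither has outgoing strokes.
  refine ⟨hc, ?_, (ruleTriangle₁_iff h).2 ht, ?_, ruleMinors_of_columnSums h ht hc.1⟩
  · exact D.circles_ne_one hA (K := Finset.univ) fun k _ j hj => absurd (Finset.mem_univ j) hj
  · intro I hI
    obtain ⟨i, rfl⟩ := (isConnComp_iff h ht).1 hI
    exact D.circles_ne_one hA (D.Zt_eq_zero_of_block hA)

theorem circles_iff_of_adj (hA : IsColorOf A zt Zt) (hB : IsColorOf B wt Wt) {i j : Fin 5}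
    (h : A i j = 1) : B i i = 1 ↔ B j j = 1 := by
  rw [hB.circ, hB.circ, D.wt_eq_of_adj hA h]

theorem ruleCircling (hA : IsColorOf A zt Zt) (hB : IsColorOf B wt Wt) : RuleCircling A B := by
  intro i j _ he
  have h1 := Nat.eq_one_of_mul_eq_one_right he
  rw [h1, one_mul] at he
  have h2 := D.circles_iff_of_adj hA hB h1
  rcases hB.bin i i with h3 | h3 <;> rcases hB.bin j j with h4 | h4 <;> omega

/-! ### Rules from clusters of circled vertices -/

/-- If all circled vertices are clustered, then their total vorticity vanishes. -/
theorem sum_eq_zero_of_cluster {K : Finset (Fin 5)} {c : ℂ} (hz : ∀ k ∈ K, zt k = c)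
    (hz0 : ∀ k, zt k ≠ 0 ↔ k ∈ K) (hK : K.Nonempty) : ∑ k ∈ K, (Γ k : ℂ) = 0 :=
  D.sum_eq_zero_of_circled (U := Finset.univ) (fun _ _ j hj => absurd (Finset.mem_univ j) hj)
    (fun k => by rw [← hz0 k]; simp) hz hK

/-- If all circled vertices are clustered, then their moment in the other color is small. -/
theorem tendsto_of_cluster {K : Finset (Fin 5)} {c : ℂ} (hz : ∀ k ∈ K, zt k = c)
    (hz0 : ∀ k, zt k ≠ 0 ↔ k ∈ K) (hK : K.Nonempty) :
    Tendsto (fun n => (R n : ℂ) * ∑ k ∈ K, (Γ k : ℂ) * w n k) atTop (𝓝 0) := by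
  refine D.swap.tendsto_sum_cluster hz (fun j hj => ?_) (D.sum_eq_zero_of_cluster hz hz0 hK)
  obtain ⟨b, hb⟩ := hK
  rw [not_ne_iff.1 (mt (hz0 j).1 hj), ← hz b hb]
  exact ((hz0 b).2 hb).symm

/-- The circled vertices are those of `K` if `K` contains as many circles as the trace counts. -/
theorem circled_iff_of_trace (hA : IsColorOf A zt Zt) {K : Finset (Fin 5)}
    (hK : ∀ k ∈ K, A k k = 1) (ht : A.trace ≤ K.card) (k : Fin 5) : zt k ≠ 0 ↔ k ∈ K := by
  have h := D.isSymmBinary hA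
  have h1 := (circles_eq_card_iff h).2 hK
  have h2 : circles A K ≤ circles A Finset.univ :=
    Finset.sum_le_sum_of_subset (Finset.subset_univ K)
  have h3 : circles A Finset.univ = A.trace := rfl
  have := (circles_eq_circles_iff h (Finset.subset_univ K)).1 ⟨by omega, h1⟩ k
  rw [← this, hA.circ]
  simp

/-- A $w$-stroke clusters the only two $z$-circled vertices, so their vorticities are opposite and
their $w$-moment is $o(1/R)$. They would then be closer in $w$ than order $1/R$. -/
theorem ruleTraceTwo (hA : IsColorOf A zt Zt) (hB : IsColorOf B wt Wt) : RuleTraceTwo A B := by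
  intro ht i j hij hi hj
  by_contra hne
  have hBij : B i j = 1 := (hB.bin i j).resolve_left (right_ne_zero_of_mul hne)
  have hK : ∀ k ∈ ({i, j} : Finset (Fin 5)), A k k = 1 := by simp [hi, hj]
  have hc : ∀ k ∈ ({i, j} : Finset (Fin 5)), zt k = zt i := by
    simp [D.swap.wt_eq_of_adj hB hBij]
  have hz0 := D.circled_iff_of_trace hA hK (by rw [ht, Finset.card_pair hij])
  have h1 := D.tendsto_of_cluster hc hz0 ⟨i, by simp⟩
  have h2 := D.sum_eq_zero_of_cluster hc hz0 ⟨i, by simp⟩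
  rw [Finset.sum_pair hij] at h2
  simp only [Finset.sum_pair hij] at h1
  exact D.not_tendsto_pair hij h2 h1

/-- No component that is fully stroked and circled, and clustered, contains all circles. -/
theorem card_lt_trace (hA : IsColorOf A zt Zt) {i : Fin 5} (hcirc : ∀ k ∈ block A i, A k k = 1)
    (hz : ∀ k ∈ block A i, zt k = zt i) : (block A i).card < A.trace := by
  by_contra! ht
  have hne : (block A i).Nonempty := ⟨i, self_mem_block i⟩
  have hz0 := D.circled_iff_of_trace hA hcirc ht
  obtain ⟨S, hS, hL⟩ := D.moment_limit_of_sum_eq_zero hne hz (D.Zt_ne_zero_of_block hA)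
    (D.Zt_eq_zero_of_block hA) (D.sum_eq_zero_of_cluster hz hz0 hne)
  rw [tendsto_nhds_unique hS (D.tendsto_of_cluster hz hz0 hne)] at hL
  exact D.sum_sq_ne_zero hne (by linear_combination hL)

theorem zt_eq_of_full (hB : IsColorOf B wt Wt) {K : Finset (Fin 5)}
    (hfull : ∀ j ∈ K, ∀ k ∈ K, j ≠ k → B j k = 1) {i : Fin 5} (hi : i ∈ K) :
    ∀ k ∈ K, zt k = zt i := by
  intro k hk
  by_cases hki : k = i
  · rw [hki]
  · exact D.swap.wt_eq_of_adj hB (hfull k hk i hi hki)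

theorem ruleTriangle₂ (hA : IsColorOf A zt Zt) (hB : IsColorOf B wt Wt) : RuleTriangle₂ A B := by
  intro K hK hcard hcA hcB
  obtain ⟨i, rfl⟩ := (isConnComp_iff (D.isSymmBinary hA) (D.strokeTrans hA)).1 hK
  have hA' := circles_mul_strokes_iff (D.isSymmBinary hA) (K := block A i) (by omega)
  have hB' := circles_mul_strokes_iff (D.swap.isSymmBinary hB) (K := block A i) (by omega)
  rw [hcard] at hA' hB'
  rw [← hcard]
  exact D.card_lt_trace hA (hA'.1 hcA).1
    (D.zt_eq_of_full hB (hB'.1 hcB).2 (self_mem_block i))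

theorem ruleQuadrilateral (hA : IsColorOf A zt Zt) (hB : IsColorOf B wt Wt) :
    RuleQuadrilateral A B := by
  intro K hK hcard hcA hcB
  obtain ⟨i, rfl⟩ := (isConnComp_iff (D.isSymmBinary hA) (D.strokeTrans hA)).1 hK
  have hA' := circles_mul_strokes_iff (D.isSymmBinary hA) (K := block A i) (by omega)
  have hB' := strokes_eq_choose_iff (D.swap.isSymmBinary hB) (K := block A i)
  rw [hcard] at hA' hB'
  rw [← hcard]
  exact D.card_lt_trace hA (hA'.1 hcA).1
    (D.zt_eq_of_full hB (hB'.1 hcB) (self_mem_block i))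

theorem ruleFullyEdged (hA : IsColorOf A zt Zt) (hB : IsColorOf B wt Wt) :
    RuleFullyEdged A B := by
  have sA := D.isSymmBinary hA
  have tA := D.strokeTrans hA
  have sB := D.swap.isSymmBinary hB
  have tB := D.swap.strokeTrans hB
  rw [ruleFullyEdged_iff sA sB tA tB]
  intro i hcard hcirc
  set K := block A i with hKdef
  have hiK : i ∈ K := self_mem_block i
  have hwt : ∀ k ∈ K, wt k = wt i := fun k hk => D.wt_eq_of_mem_block hA hk
  have hzt : ∀ k ∈ K, zt k = 0 := fun k hk => not_ne_iff.1 (mt (hA.circ k).2 (hcirc k hk))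
  have hsq := D.sq_sum_of_uncircled ⟨i, hiK⟩ hzt (D.Zt_ne_zero_of_block hA)
    (D.Zt_eq_zero_of_block hA)
  -- The square of the total vorticity of `K` equals the sum of squares, which is positive.
  have hΓ : ∑ k ∈ K, (Γ k : ℂ) ≠ 0 := by
    intro h0
    rw [h0] at hsq
    exact D.sum_sq_ne_zero ⟨i, hiK⟩ (by rw [← hsq]; ring)
  refine ⟨fun y => ⟨fun x hx _ hz => ?_, ?_⟩, fun hz => ?_⟩
  · have hne : (K.erase x).Nonempty := by
      rw [← Finset.card_pos, Finset.card_erase_of_mem hx]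
      omega
    have h0 := D.swap.sum_eq_zero_of_circled (U := block B y) (K := K.erase x) (c := wt i)
      (D.swap.Zt_eq_zero_of_block hB) (fun k => by rw [← hz k, hB.circ])
      (fun k hk => hwt k (Finset.mem_of_mem_erase hk)) hne
    rw [← Finset.sum_erase_add _ _ hx, ← Finset.sum_erase_add _ _ hx, h0, zero_add] at hsq
    exact D.sum_sq_ne_zero hne (by linear_combination -hsq)
  · rintro ⟨hsub, hc, hJ⟩
    have hsqJ := D.swap.sq_sum_of_uncircled (K := block B y) ⟨y, self_mem_block y⟩
      (fun k hk => not_ne_iff.1 (mt (hB.circ k).2 (hJ k hk))) (D.swap.Zt_ne_zero_of_block hB)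
      (D.swap.Zt_eq_zero_of_block hB)
    obtain ⟨x, hxJ⟩ : ∃ x, block B y \ K = {x} := by
      rw [← Finset.card_eq_one, Finset.card_sdiff_of_subset hsub]
      omega
    rw [← Finset.sum_sdiff hsub, ← Finset.sum_sdiff hsub, hxJ, Finset.sum_singleton,
      Finset.sum_singleton] at hsqJ
    have hx : (Γ x : ℂ) ≠ 0 := by exact_mod_cast D.Γ_ne x
    have h2 : 2 * (Γ x : ℂ) * ∑ k ∈ K, (Γ k : ℂ) = 0 := by linear_combination hsqJ - hsq
    -- Both `K` and `K` with `x` added satisfy the identity of squares, so the cross term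
    -- $2\Gamma_x\sum_K\Gamma_k$ vanishes.
    exact hΓ ((mul_eq_zero.1 h2).resolve_left (mul_ne_zero two_ne_zero hx))
  · refine hΓ (D.swap.sum_eq_zero_of_circled (U := K.biUnion (block B)) (c := wt i) ?_ ?_ hwt
      ⟨i, hiK⟩)
    · intro k hk j hj
      obtain ⟨x, hx, hkx⟩ := Finset.mem_biUnion.1 hk
      exact D.swap.Zt_eq_zero_of_block hB k hkx j
        fun hjx => hj (Finset.mem_biUnion.2 ⟨x, hx, hjx⟩)
    · intro k
      rw [← hz k, Finset.mem_biUnion, hB.circ]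

theorem ruleDumbbells (hA : IsColorOf A zt Zt) (hB : IsColorOf B wt Wt) : RuleDumbbells A B := by
  have sA := D.isSymmBinary hA
  have tA := D.strokeTrans hA
  have sB := D.swap.isSymmBinary hB
  have tB := D.swap.strokeTrans hB
  intro K₁ K₂ hK₁ hK₂ hne hd
  obtain ⟨i, rfl⟩ := (isConnComp_iff sA tA).1 hK₁
  obtain ⟨j, rfl⟩ := (isConnComp_iff sA tA).1 hK₂
  have hdec : ∀ l, l = i ∨ l = j → (block A l).card = 2 ∧ (∀ k ∈ block A l, A k k = 1) ∧
      (∀ k ∈ block A l, B k k = 1) ∧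
      ∀ k ∈ block A l, ∀ m ∈ block A l, k ≠ m → B k m = 1 := by
    intro l hl
    obtain ⟨h1, h2, h3⟩ := hd (block A l) (hl.imp (fun h => by rw [h]) fun h => by rw [h])
    have hA' := circles_mul_strokes_iff sA (K := block A l) (by omega)
    have hB' := circles_mul_strokes_iff sB (K := block A l) (by omega)
    rw [h1] at hA' hB'
    exact ⟨h1, (hA'.1 h2).1, hB'.1 h3⟩
  obtain ⟨c₁, a₁, b₁, f₁⟩ := hdec i (Or.inl rfl)
  obtain ⟨c₂, a₂, b₂, f₂⟩ := hdec j (Or.inr rfl)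
  by_contra! hle
  have hdisj : Disjoint (block A i) (block A j) := by
    rw [Finset.disjoint_left]
    intro k h1 h2
    exact hne ((block_eq sA tA h1).symm.trans (block_eq sA tA h2))
  set U := block A i ∪ block A j with hU
  have hUcard : U.card = 4 := by rw [hU, Finset.card_union_of_disjoint hdisj, c₁, c₂]
  have aU : ∀ k ∈ U, A k k = 1 := fun k hk => (Finset.mem_union.1 hk).elim (a₁ k) (a₂ k)
  have bU : ∀ k ∈ U, B k k = 1 := fun k hk => (Finset.mem_union.1 hk).elim (b₁ k) (b₂ k)
  have hle₁ : ∀ {M : Matrix (Fin 5) (Fin 5) ℕ}, IsSymmBinary M → (∀ k ∈ U, M k k = 1) →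
      4 ≤ M.trace := by
    intro M hM h
    rw [← hUcard, ← (circles_eq_card_iff hM).2 h]
    exact Finset.sum_le_sum_of_subset (Finset.subset_univ U)
  -- Both traces are at least 4 with sum at most 8, so each is 4 and `U` is the circled set of both
  -- colors.
  have tA4 := hle₁ sA aU
  have tB4 := hle₁ sB bU
  have hzU := D.circled_iff_of_trace hA aU (by omega)
  have hwU := D.swap.circled_iff_of_trace hB bU (by omega)
  have hsum : ∀ l, (∀ k ∈ block A l, ∀ m ∈ block A l, k ≠ m → B k m = 1) →
      (∀ k ∈ block A l, A k k = 1) → ∑ k ∈ block A l, (Γ k : ℂ) = 0 := fun l hf ha =>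
    D.sum_eq_zero_of_circled (U := block A l) (D.Zt_eq_zero_of_block hA)
      (fun k => and_iff_left_of_imp fun hk => (hA.circ k).1 (ha k hk))
      (D.zt_eq_of_full hB hf (self_mem_block l)) ⟨l, self_mem_block l⟩
  have hs₁ := hsum i f₁ a₁
  have hs₂ := hsum j f₂ a₂
  have hw₁ : ∀ k ∈ block A i, wt k = wt i := fun k hk => D.wt_eq_of_mem_block hA hk
  have hw₂ : ∀ k ∈ block A j, wt k = wt j := fun k hk => D.wt_eq_of_mem_block hA hk
  have hi0 : wt i ≠ 0 := (hwU i).2 (Finset.mem_union_left _ (self_mem_block i))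
  -- If the two pairs share their $w$-limit, `U` is one cluster whose $z$-moment is $o(1/R)$, while
  -- the moment identity on the $w$-blocks covering it gives a nonzero limit. Otherwise one pair is
  -- a whole $w$-cluster by itself, and its $z$-moment is too small.
  by_cases hij : wt i = wt j
  · have hwt : ∀ k ∈ U, wt k = wt i := fun k hk =>
      (Finset.mem_union.1 hk).elim (hw₁ k) fun h => (hw₂ k h).trans hij.symm
    have hiU : i ∈ U := Finset.mem_union_left _ (self_mem_block i)
    have hjU : j ∈ U := Finset.mem_union_right _ (self_mem_block j)
    have hlim := D.swap.tendsto_of_cluster hwt hwU ⟨i, hiU⟩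
    have hsub : ∀ l ∈ U, block B l ⊆ U := by
      intro l hl k hk
      rw [← hzU, D.swap.wt_eq_of_mem_block hB hk]
      exact (hzU l).2 hl
    have hsub₁ : ∀ l, (∀ k ∈ block A l, ∀ m ∈ block A l, k ≠ m → B k m = 1) →
        block A l ⊆ block B l := by
      intro l hf k hk
      by_cases hlk : l = k
      · exact mem_block.2 (Or.inl hlk)
      · exact mem_block.2 (Or.inr (hf l (self_mem_block l) k hk hlk))
    have hmom : ∀ l ∈ U, ∑ k ∈ block B l, (Γ k : ℂ) = 0 →
        ∃ S, Tendsto (fun n => (R n : ℂ) * ∑ k ∈ block B l, (Γ k : ℂ) * z n k) atTop (𝓝 S) ∧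
          2 * (Λ' * wt i * S) = -∑ k ∈ block B l, (Γ k : ℂ) ^ 2 := fun l hl h0 =>
      D.swap.moment_limit_of_sum_eq_zero ⟨l, self_mem_block l⟩
        (fun k hk => hwt k (hsub l hl hk)) (D.swap.Zt_ne_zero_of_block hB)
        (D.swap.Zt_eq_zero_of_block hB) h0
    -- Either `U` is a single $w$-component or the two pairs are separate ones. In the second case
    -- their moment identities are added.
    by_cases hlink : j ∈ block B i
    · have hBU : block B i = U := by
        refine le_antisymm (hsub i hiU) (Finset.union_subset (hsub₁ i f₁) ?_)
        rw [← block_eq sB tB hlink]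
        exact hsub₁ j f₂
      obtain ⟨S, hS, hL⟩ := hmom i hiU (by rw [hBU, hU, Finset.sum_union hdisj, hs₁, hs₂, add_zero])
      rw [hBU] at hS hL
      rw [tendsto_nhds_unique hS hlim] at hL
      exact D.sum_sq_ne_zero ⟨i, hiU⟩ (by linear_combination hL)
    · have hB₁ : block B i = block A i := by
        refine le_antisymm (fun k hk => ?_) (hsub₁ i f₁)
        refine (Finset.mem_union.1 (hsub i hiU hk)).resolve_right fun hkj => hlink ?_
        exact mem_block_trans tB hk (mem_block_symm sB (hsub₁ j f₂ hkj))
      have hB₂ : block B j = block A j := by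
        refine le_antisymm (fun k hk => ?_) (hsub₁ j f₂)
        refine (Finset.mem_union.1 (hsub j hjU hk)).resolve_left fun hki => hlink ?_
        exact mem_block_trans tB (hsub₁ i f₁ hki) (mem_block_symm sB hk)
      obtain ⟨S₁, hS₁, hL₁⟩ := hmom i hiU (by rw [hB₁, hs₁])
      obtain ⟨S₂, hS₂, hL₂⟩ := hmom j hjU (by rw [hB₂, hs₂])
      rw [hB₁] at hS₁ hL₁
      rw [hB₂] at hS₂ hL₂
      have hS := tendsto_nhds_unique ((hS₁.add hS₂).congr fun n => by
        rw [← mul_add, ← Finset.sum_union hdisj]) hlim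
      refine D.sum_sq_ne_zero ⟨i, hiU⟩ ?_
      rw [hU, Finset.sum_union hdisj]
      linear_combination hL₁ + hL₂ - 2 * Λ' * wt i * hS
  · have hlim := D.tendsto_sum_cluster hw₁ (fun k hk => ?_) hs₁
    · obtain ⟨x, y, hxy, hK⟩ := Finset.card_eq_two.1 c₁
      rw [hK, Finset.sum_pair hxy] at hs₁
      simp only [hK, Finset.sum_pair hxy] at hlim
      exact D.swap.not_tendsto_pair hxy hs₁ hlim
    · by_cases hkj : k ∈ block A j
      · rw [hw₂ k hkj]
        exact Ne.symm hij
      · have : wt k = 0 := not_ne_iff.1 (mt (hwU k).1 fun hkU =>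
          (Finset.mem_union.1 hkU).elim hk hkj)
        rw [this]
        exact hi0.symm

theorem mixedRules (hA : IsColorOf A zt Zt) (hB : IsColorOf B wt Wt) : MixedRules A B :=
  ⟨D.ruleCircling hA hB, D.ruleTraceTwo hA hB, D.ruleFullyEdged hA hB, D.ruleTriangle₂ hA hB,
    D.ruleQuadrilateral hA hB, D.ruleDumbbells hA hB⟩

theorem satisfiesRules (hA : IsColorOf A zt Zt) (hB : IsColorOf B wt Wt) :
    SatisfiesRules (A, B) :=
  ⟨D.singleRules hA, D.swap.singleRules hB, D.mixedRules hA hB, D.swap.mixedRules hB hA⟩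

end LimitData

/-! ### Limit data of a singular sequence -/

section Extraction

variable {N : ℕ} {Γ : Fin N → ℝ} {Λ : ℂ} {𝒵 𝒲 : ℕ → Coord N → ℂ}

theorem pairVar_anti (X : Coord N → ℂ) (j k : Fin N) : pairVar X j k = -pairVar X k j := by
  unfold pairVar
  rcases lt_trichotomy j k with h | rfl | h
  · simp [h, h.asymm]
  · simp
  · simp [h, h.asymm]

theorem pairVar_self (X : Coord N → ℂ) (j : Fin N) : pairVar X j j = 0 := by
  simp [pairVar]

/-- The coordinates of a vector of `Coord N → ℂ` as an antisymmetric array, applied to limits. -/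
theorem tendsto_pairVar {X : ℕ → Coord N → ℂ} {r : ℕ → ℂ} {l : Coord N → ℂ}
    (h : Tendsto (fun n => r n • X n) atTop (𝓝 l)) (j k : Fin N) :
    Tendsto (fun n => r n * pairVar (X n) j k) atTop (𝓝 (pairVar l j k)) := by
  have h' := tendsto_pi_nhds.1 h
  unfold pairVar
  split_ifs with h₁ h₂
  · exact h' _
  · simpa only [mul_neg, Pi.smul_apply, smul_eq_mul] using (h' (Sum.inr ⟨(k, j), h₂⟩)).neg
  · simp

theorem IsSingularSequence.swap (h : IsSingularSequence Γ Λ 𝒵 𝒲) :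
    IsSingularSequence Γ (starRingEnd ℂ Λ) 𝒲 𝒵 where
  isCC n := ⟨(h.isCC n).w_eq, by simpa using (h.isCC n).z_eq, (h.isCC n).W_mul, (h.isCC n).Z_mul,
    (h.isCC n).norm_eq.symm⟩
  unbounded := h.unbounded.congr fun n => (h.isCC n).norm_eq
  max_z := h.max_w
  max_w := h.max_z
  lim_z := h.lim_w
  lim_w := h.lim_z

/-- The fixed coordinate of maximal modulus has rescaled modulus 1, and so has its limit. -/
theorem limit_nonzero {X : ℕ → Coord N → ℂ} (hX : Tendsto (fun n => ‖X n‖) atTop atTop)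
    (hmax : ∃ c, ∀ n, ‖X n‖ = ‖X n c‖) {l : Coord N → ℂ}
    (hl : Tendsto (fun n => ((‖X n‖ : ℂ)⁻¹) • X n) atTop (𝓝 l)) :
    (∃ k, pos l k ≠ 0) ∨ ∃ j k, j ≠ k ∧ pairVar l j k ≠ 0 := by
  obtain ⟨c, hc⟩ := hmax
  have hlc : l c ≠ 0 := by
    have h1 := ((tendsto_pi_nhds.1 hl) c).norm
    have h2 : Tendsto (fun n => ‖((‖X n‖ : ℂ)⁻¹ • X n) c‖) atTop (𝓝 1) := by
      refine tendsto_const_nhds.congr' ?_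
      filter_upwards [hX.eventually_gt_atTop 0] with n hn
      rw [Pi.smul_apply, norm_smul, norm_inv, Complex.norm_real, norm_norm, ← hc n,
        inv_mul_cancel₀ hn.ne']
    rw [← norm_ne_zero_iff, tendsto_nhds_unique h1 h2]
    exact one_ne_zero
  rcases c with k | ⟨⟨j, k⟩, hjk⟩
  · exact Or.inl ⟨k, hlc⟩
  · refine Or.inr ⟨j, k, ne_of_lt hjk, ?_⟩
    rwa [pairVar, dif_pos hjk]

/-- A zero limit means that `a` is negligible against the norm; being also of its order would make
the norm negligible against itself. -/
theorem isMaximalOrder_iff {X : ℕ → Coord N → ℂ} (hX : Tendsto (fun n => ‖X n‖) atTop atTop)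
    {a : ℕ → ℂ} {l : ℂ} (ha : Tendsto (fun n => (‖X n‖ : ℂ)⁻¹ * a n) atTop (𝓝 l)) :
    IsMaximalOrder X a ↔ l ≠ 0 := by
  have hne : ∀ᶠ n in atTop, ‖X n‖ ≠ 0 := by
    filter_upwards [hX.eventually_gt_atTop 0] with n hn
    exact hn.ne'
  have hdiv : Tendsto (fun n => a n / (‖X n‖ : ℂ)) atTop (𝓝 l) :=
    ha.congr fun n => by rw [div_eq_inv_mul]
  have hcast : IsMaximalOrder X a ↔ a =Θ[atTop] fun n => (‖X n‖ : ℂ) := by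
    rw [IsMaximalOrder, ← Asymptotics.isTheta_norm_right,
      ← Asymptotics.isTheta_norm_right (g' := fun n => (‖X n‖ : ℂ))]
    simp only [Complex.norm_real]
  rw [hcast]
  constructor
  · rintro h rfl
    have h1 : a =o[atTop] fun n => (‖X n‖ : ℂ) := by
      refine (Asymptotics.isLittleO_iff_tendsto' ?_).2 hdiv
      filter_upwards [hne] with n hn h0
      exact absurd (by exact_mod_cast h0) hn
    have h2 := h.2.trans_isLittleO h1
    have h3 := Asymptotics.isLittleO_irrefl
      (Filter.Eventually.frequently (f := atTop) (p := fun n => (‖X n‖ : ℂ) ≠ 0)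
        (by filter_upwards [hne] with n hn; exact_mod_cast hn))
    exact h3 h2
  · intro hl
    exact (Asymptotics.isTheta_of_div_tendsto_nhds_ne_zero hdiv hl).symm

theorem IsSingularSequence.limitData (h : IsSingularSequence Γ Λ 𝒵 𝒲) (hΓ : ∀ k, Γ k ≠ 0)
    (hΛ : ‖Λ‖ = 1) {l l' : Coord N → ℂ}
    (hl : Tendsto (fun n => ((‖𝒵 n‖ : ℂ)⁻¹) • 𝒵 n) atTop (𝓝 l))
    (hl' : Tendsto (fun n => ((‖𝒲 n‖ : ℂ)⁻¹) • 𝒲 n) atTop (𝓝 l')) :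
    LimitData Γ Λ (starRingEnd ℂ Λ) (fun n => ‖𝒵 n‖) (fun n => pos (𝒵 n)) (fun n => pos (𝒲 n))
      (fun n => pairVar (𝒵 n)) (fun n => pairVar (𝒲 n)) (pos l) (pos l') (pairVar l)
      (pairVar l') := by
  have hΛ0 : Λ ≠ 0 := by
    rw [← norm_ne_zero_iff, hΛ]
    exact one_ne_zero
  -- The normalization of equal norms lets both colors be rescaled by one common size.
  have hl'' : Tendsto (fun n => ((‖𝒵 n‖ : ℂ)⁻¹) • 𝒲 n) atTop (𝓝 l') :=
    hl'.congr fun n => by rw [(h.isCC n).norm_eq]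
  have hsum : ∀ (X : Coord N → ℂ) (k : Fin N), ∑ j ∈ Finset.univ.erase k, (Γ j : ℂ) *
      pairVar X j k = ∑ j, (Γ j : ℂ) * pairVar X j k := fun X k =>
    Finset.sum_erase _ (by rw [pairVar_self, mul_zero])
  have hmul : ∀ X Y : Coord N → ℂ, (∀ j k, j < k → pairVar X j k * (pos Y k - pos Y j) = 1) →
      ∀ j k, j ≠ k → pairVar X j k * (pos Y k - pos Y j) = 1 := by
    intro X Y hXY j k hjk
    rcases lt_or_gt_of_ne hjk with hlt | hlt
    · exact hXY j k hlt
    · rw [pairVar_anti]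
      linear_combination hXY k j hlt
  exact
    { Γ_ne := hΓ
      Λ_ne := hΛ0
      Λ'_ne := (map_ne_zero _).2 hΛ0
      R_lim := h.unbounded
      z_eq := fun n k => by rw [(h.isCC n).z_eq, hsum]
      w_eq := fun n k => by rw [(h.isCC n).w_eq, hsum]
      Z_mul := fun n => hmul _ _ (h.isCC n).Z_mul
      W_mul := fun n => hmul _ _ (h.isCC n).W_mul
      Z_anti := fun n => pairVar_anti _
      W_anti := fun n => pairVar_anti _
      z_lim := fun k => tendsto_pi_nhds.1 hl (Sum.inl k)
      w_lim := fun k => tendsto_pi_nhds.1 hl'' (Sum.inl k)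
      Z_lim := tendsto_pairVar hl
      W_lim := tendsto_pairVar hl''
      z_nonzero := limit_nonzero h.unbounded h.max_z hl
      w_nonzero := limit_nonzero h.swap.unbounded h.max_w hl' }

end Extraction

theorem isColorOf_colorMatrix {X : ℕ → Coord 5 → ℂ}
    (hX : Tendsto (fun n => ‖X n‖) atTop atTop) {l : Coord 5 → ℂ}
    (hl : Tendsto (fun n => ((‖X n‖ : ℂ)⁻¹) • X n) atTop (𝓝 l)) :
    IsColorOf (colorMatrix X) (pos l) (pairVar l) where
  bin i j := by
    simp only [colorMatrix, Matrix.of_apply]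
    split_ifs <;> simp
  circ i := by
    refine Iff.trans ?_ (isMaximalOrder_iff hX (tendsto_pi_nhds.1 hl (Sum.inl i)))
    simp only [colorMatrix, Matrix.of_apply, if_true, ite_eq_left_iff, zero_ne_one, imp_false,
      not_not]
    rfl
  stroke i j hij := by
    refine Iff.trans ?_ (isMaximalOrder_iff hX (tendsto_pairVar hl i j))
    simp only [colorMatrix, Matrix.of_apply, if_neg hij, ite_eq_left_iff, zero_ne_one, imp_false,
      not_not]

end FiveVortex

theorem mainTheorem1 :
    FiveVortex.diagrams.length = 31 ∧
    FiveVortex.diagrams.Pairwise (fun D D' => ¬ FiveVortex.SameDiagram D D') ∧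
    (∀ P : FiveVortex.ZWMatrix 5,
      (FiveVortex.IsSymmBinary P.1 ∧ FiveVortex.IsSymmBinary P.2 ∧
        FiveVortex.SatisfiesRules P) ↔
      ∃ D ∈ FiveVortex.diagrams, FiveVortex.SameDiagram D P) ∧
    (∀ (Γ : Fin 5 → ℝ) (Λ : ℂ) (𝒵 𝒲 : ℕ → FiveVortex.Coord 5 → ℂ),
      (∀ k, Γ k ≠ 0) → ‖Λ‖ = 1 → FiveVortex.IsSingularSequence Γ Λ 𝒵 𝒲 →
      ∃ D ∈ FiveVortex.diagrams, FiveVortex.SameDiagram D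
        (FiveVortex.colorMatrix 𝒵, FiveVortex.colorMatrix 𝒲)) := by
  refine ⟨rfl, ?_, FiveVortex.rules_iff_sameDiagram, ?_⟩
  · exact FiveVortex.diagrams_pairwise_invariant.imp fun hne h => hne h.diagramInvariant_eq
  · intro Γ Λ 𝒵 𝒲 hΓ hΛ h
    obtain ⟨l, hl⟩ := h.lim_z
    obtain ⟨l', hl'⟩ := h.lim_w
    have D := h.limitData hΓ hΛ hl hl'
    have hA := FiveVortex.isColorOf_colorMatrix h.unbounded hl
    have hB := FiveVortex.isColorOf_colorMatrix h.swap.unbounded hl'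
    exact (FiveVortex.rules_iff_sameDiagram _).1
      ⟨D.isSymmBinary hA, D.swap.isSymmBinary hB, D.satisfiesRules hA hB⟩
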